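/- Notation. Let $\mathbb S^2\subset\mathbb R^3$ be the unit sphere with surface measure $dx$ and spherical coordinates $(\theta,\varphi)$, $\theta$ being the angle with the North Pole, and let $P_\ell$ be the Legendre polynomials. For $0\le m\le \ell$ let $P_{\ell m}(t)=(-1)^m(1-t^2)^{m/2}\frac{d^m}{dt^m}P_\ell(t)$ and $$Y_{\ell m}(\theta,\varphi)=\sqrt{\tfrac{2\ell+1}{4\pi}}\sqrt{\tfrac{(\ell-m)!}{(\ell+m)!}}\,P_{\ell m}(\cos\theta)e^{im\varphi},\qquad Y_{\ell,-m}=(-1)^m\overline{Y_{\ell m}} .$$ The random eigenfunction of degree $\ell$ is $$T_\ell(x)=\sqrt{\tfrac{4\pi}{2\ell+1}}\sum_{m=-\ell}^{\ell}a_{\ell m}Y_{\ell m}(x),$$ where $a_{\ell m}=(-1)^m\overline{a_{\ell,-m}}$ almost surely, $a_{\ell 0},\dots,a_{\ell\ell}$ are independent, $a_{\ell 0}$ is real standard Gaussian, and for $1\le m\le\ell$ the coefficient $a_{\ell m}$ is standard complex Gaussian (independent real and imaginary parts of law $N(0,\frac12)$). Let $H_2(t)=t^2-1$. For $k\ge 0$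 let $q_{2k+1}(t)=\sum_{i=0}^{k}\binom{2k+1}{i}t^i(1-t)^{2k+1-i}$. For $0<r<\pi$ let $B=\{\theta\le r\}$ be the cap of radius $r$ around the North Pole, and for $0<\varepsilon<r$ let $1_{B;\varepsilon}(x)=\phi_{r,\varepsilon}(\theta_x)$, where $\phi_{r,\varepsilon}(\theta)$ equals $1$ for $\theta<r-\varepsilon$, $q_{2k+1}\big(\frac{\theta-r+\varepsilon}{\varepsilon}\big)$ for $r-\varepsilon\le\theta\le r$, and $0$ for $\theta>r$. Let $$b_{L;\varepsilon}=\int_{\mathbb S^2}1_{B;\varepsilon}(x)Y_{L0}(x)\,dx=2\pi\sqrt{\tfrac{2L+1}{4\pi}}\int_{-1}^{1}\phi_{r,\varepsilon}(\arccos\mu)P_L(\mu)\,d\mu$$ be its Fourier coefficients, and let $C_{\ell 0\ell 0}^{L0}$ denote the Clebsch-Gordan coefficients (zero unless $0\le L\le 2\ell$). Statement. For every $r\in(0,\pi)$ there are constants $0<c_1\le c_2$, depending only on $r$, such that for all integers $k\ge 0$, all $\varepsilon\in(0,r)$ and all integers $\ell\ge 1$ $$\frac{c_1}{\ell}\;\le\;\operatorname{Var}\Big(\int_{\mathbb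 S^2}1_{B;\varepsilon}(x)H_2(T_\ell(x))\,dx\Big)=8\pi\sum_{L=0}^{\infty}b_{L;\varepsilon}^2\,\frac{1}{2L+1}\Big(C_{\ell 0\ell 0}^{L0}\Big)^2\;\le\;\frac{c_2}{\ell}.$$ In particular, along any choice $\varepsilon=\varepsilon_\ell\in(0,r)$, fixed or tending to $0$, the variance has exact order $1/\ell$ as $\ell\to\infty$. -/

import Mathlib

open MeasureTheory ProbabilityTheory

namespace CapHarmonics

noncomputable section

/-- The unit sphere `𝕊²` in three-dimensional Euclidean space. -/
abbrev S2 : Type := Metric.sphere (0 : EuclideanSpace ℝ (Fin 3)) 1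

/-- The surface measure `dx` of `𝕊²` (total mass `4π`). -/
def surface : Measure S2 := (volume : Measure (EuclideanSpace ℝ (Fin 3))).toSphere

/-- The colatitude `θ ∈ [0, π]` of a point: its angle with the North Pole `(0, 0, 1)`. -/
def colatitude (x : S2) : ℝ := Real.arccos (x.1 2)

/-- The longitude of a point, normalised to `(-π, π]`; it enters only through `exp (i m φ)`. -/
def longitude (x : S2) : ℝ := Complex.arg ⟨x.1 0, x.1 1⟩

/-- The Legendre polynomial `P_ℓ`, by Rodrigues' formula. -/
def legendre (l : ℕ) : Polynomial ℝ :=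
  Polynomial.C (1 / (2 ^ l * (l.factorial : ℝ))) *
    Polynomial.derivative^[l] ((Polynomial.X ^ 2 - 1) ^ l)

/-- The associated Legendre function
`P_{ℓ m}(t) = (-1)^m (1 - t²)^{m/2} (d/dt)^m P_ℓ(t)`, for `m ≥ 0` and `t ∈ [-1, 1]`. -/
def assocLegendre (l m : ℕ) (t : ℝ) : ℝ :=
  (-1) ^ m * Real.sqrt (1 - t ^ 2) ^ m * (Polynomial.derivative^[m] (legendre l)).eval t

/-- `Y_{ℓ m}(θ, φ)` for `0 ≤ m ≤ ℓ`. -/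
def harmonicNonneg (l m : ℕ) (θ φ : ℝ) : ℂ :=
  ((Real.sqrt ((2 * l + 1) / (4 * Real.pi)) *
      Real.sqrt (((l - m).factorial : ℝ) / ((l + m).factorial : ℝ)) *
      assocLegendre l m (Real.cos θ) : ℝ) : ℂ) * Complex.exp (Complex.I * m * φ)

/-- The spherical harmonic `Y_{ℓ m}(θ, φ)` for `-ℓ ≤ m ≤ ℓ`, with
`Y_{ℓ m} = (-1)^m conj Y_{ℓ, -m}` for `m < 0`. -/
def harmonic (l : ℕ) (m : ℤ) (θ φ : ℝ) : ℂ :=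
  if 0 ≤ m then harmonicNonneg l m.natAbs θ φ
  else (-1) ^ m.natAbs * (starRingEnd ℂ) (harmonicNonneg l m.natAbs θ φ)

/-- The standard complex Gaussian law: independent real and imaginary parts, each `N(0, 1/2)`. -/
def stdComplexGaussian : Measure ℂ :=
  ((gaussianReal 0 (1 / 2)).prod (gaussianReal 0 (1 / 2))).map
    (fun p : ℝ × ℝ => (⟨p.1, p.2⟩ : ℂ))

/-- The random coefficients `a_{ℓ m}`, `-ℓ ≤ m ≤ ℓ`: independent apart from the relation
`a_{ℓ m} = (-1)^m conj a_{ℓ, -m}`, with `a_{ℓ 0}` real standard Gaussian and `a_{ℓ m}` standard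
complex Gaussian for `m ≠ 0`. (For `m < 0` the law follows from the relation; for `m = 0` the
relation says that `a_{ℓ 0}` is real. Values of `a` at `|m| > ℓ` play no role.) -/
structure IsGaussianCoeff {Ω : Type*} [MeasurableSpace Ω] (P : Measure Ω) (l : ℕ)
    (a : ℤ → Ω → ℂ) : Prop where
  conj_symm : ∀ m : ℕ, m ≤ l →
    ∀ᵐ ω ∂P, a m ω = (-1) ^ m * (starRingEnd ℂ) (a (-(m : ℤ)) ω)
  law_zero : HasLaw (fun ω => (a 0 ω).re) (gaussianReal 0 1) P
  law_pos : ∀ m : ℕ, 1 ≤ m → m ≤ l → HasLaw (a m) stdComplexGaussian P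
  indep : iIndepFun (fun m : Fin (l + 1) => a ((m : ℕ) : ℤ)) P

/-- The random eigenfunction
`T_ℓ(x) = √(4π / (2ℓ+1)) ∑_{m=-ℓ}^{ℓ} a_{ℓ m} Y_{ℓ m}(x)`. The sum is almost surely real by the
relation between the coefficients; taking its real part only fixes the type. -/
def randomHarmonic {Ω : Type*} (l : ℕ) (a : ℤ → Ω → ℂ) (x : S2) (ω : Ω) : ℝ :=
  Real.sqrt (4 * Real.pi / (2 * l + 1)) *
    (∑ m ∈ Finset.Icc (-(l : ℤ)) (l : ℤ),
      a m ω * harmonic l m (colatitude x) (longitude x)).re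

/-- The polynomial `q_{2k+1} = ∑_{i=0}^{k} B_i^{(2k+1)}`, a sum of Bernstein polynomials. -/
def blend (k : ℕ) : Polynomial ℝ :=
  ∑ i ∈ Finset.range (k + 1), bernsteinPolynomial ℝ (2 * k + 1) i

/-- The radial profile `φ_{r,ε}(θ)`: it is `1` on `[0, r - ε)`, `q_{2k+1}((θ - r + ε) / ε)` on
`[r - ε, r]` and `0` beyond `r`. -/
def profile (k : ℕ) (r ε θ : ℝ) : ℝ :=
  if θ < r - ε then 1
  else if θ ≤ r then (blend k).eval ((θ - r + ε) / ε)
  else 0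

/-- The smoothed indicator `1_{B,ε}` of the cap of radius `r` around the North Pole. -/
def capMollifier (k : ℕ) (r ε : ℝ) (x : S2) : ℝ := profile k r ε (colatitude x)

/-- The Fourier coefficient `b_{L;ε} = ∫_{𝕊²} 1_{B,ε}(x) Y_{L0}(x) dx` of `1_{B,ε}` in
`1_{B,ε} = ∑_L b_{L;ε} Y_{L0}`, written in the variable `μ = cos θ`:
`b_{L;ε} = 2π √((2L+1)/(4π)) ∫_{-1}^{1} φ_{r,ε}(arccos μ) P_L(μ) dμ`. -/
def fourierCoeff (k : ℕ) (r ε : ℝ) (L : ℕ) : ℝ :=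
  2 * Real.pi * Real.sqrt ((2 * L + 1) / (4 * Real.pi)) *
    ∫ μ in (-1 : ℝ)..1, profile k r ε (Real.arccos μ) * (legendre L).eval μ

/-- `1 / n!` for an integer `n`, with the usual value `0` at negative `n`. -/
def invFact (n : ℤ) : ℝ := if 0 ≤ n then 1 / (n.toNat.factorial : ℝ) else 0

/-- The Clebsch-Gordan coefficient `C_{l₁ m₁ l₂ m₂}^{l₃ m₃}`, by Racah's (van der Waerden's)
formula; it vanishes unless `|mᵢ| ≤ lᵢ`, `m₁ + m₂ = m₃` and `|l₁ - l₂| ≤ l₃ ≤ l₁ + l₂`. The sum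
runs over all `z` for which the arguments of all factorials are non-negative. -/
def clebschGordan (l₁ : ℕ) (m₁ : ℤ) (l₂ : ℕ) (m₂ : ℤ) (l₃ : ℕ) (m₃ : ℤ) : ℝ :=
  if |m₁| ≤ l₁ ∧ |m₂| ≤ l₂ ∧ |m₃| ≤ l₃ ∧ m₁ + m₂ = m₃ ∧
      l₁ ≤ l₂ + l₃ ∧ l₂ ≤ l₁ + l₃ ∧ l₃ ≤ l₁ + l₂ then
    Real.sqrt ((2 * l₃ + 1) *
        (((l₁ + l₂ - l₃).factorial * (l₁ + l₃ - l₂).factorial * (l₂ + l₃ - l₁).factorial : ℕ) : ℝ) /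
        ((l₁ + l₂ + l₃ + 1).factorial : ℝ)) *
      Real.sqrt (((l₁ + m₁).toNat.factorial * (l₁ - m₁).toNat.factorial *
        (l₂ + m₂).toNat.factorial * (l₂ - m₂).toNat.factorial *
        (l₃ + m₃).toNat.factorial * (l₃ - m₃).toNat.factorial : ℕ) : ℝ) *
      ∑ z ∈ Finset.range (l₁ + l₂ + 1),
        (-1 : ℝ) ^ z * invFact z * invFact (l₁ + l₂ - l₃ - z) * invFact (l₁ - m₁ - z) *
          invFact (l₂ + m₂ - z) * invFact (l₃ - l₂ + m₁ + z) * invFact (l₃ - l₁ - m₂ + z)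
  else 0

/-- The smoothed second chaotic component `∫_{𝕊²} 1_{B,ε}(x) H₂(T_ℓ(x)) dx`, where `H₂` is the
second (probabilists') Hermite polynomial. -/
def secondChaos {Ω : Type*} (k : ℕ) (r ε : ℝ) (l : ℕ) (a : ℤ → Ω → ℂ) (ω : Ω) : ℝ :=
  ∫ x, capMollifier k r ε x *
    Polynomial.aeval (randomHarmonic l a x ω) (Polynomial.hermite 2) ∂surface

end

end CapHarmonics

namespace CapHarmonics
open Polynomial

/-! ### Algebra of the Legendre polynomials -/

/-! Write `w_m = assocSq l m` for the squared normalised associated Legendre functions and `W(p) = ∫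
f p` over `[-1, 1]`, where `f = capWeight k r ε` is the profile in `μ = cos θ`. The weight is
radial, so integrating out the longitude kills all cross terms between different orders, and the
integral of `f H₂(T_l)` becomes a constant plus a linear combination of the independent variables
`a_0²` and `|a_m|²` with coefficients proportional to `W(w_m)`. Hence the variance is `8π² (W(w_0)²
+ 2 ∑_{m≥1} W(w_m)²)` (`variance_secondChaos`).

The upper bound is read off from this form: `w_m ≥ 0`, `|f| ≤ 1` and `∫ w_m = 2/(2l+1)` for every
`m`, so the `2l+1` squares add up to at most `4/(2l+1)`.

The expansion in `L` comes from diagonalising the same form. The Legendre operator maps `w_m` to a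
combination of `w_{m-1}, w_m, w_{m+1}`. Since it is symmetric with `P_L` as eigenfunctions, the
vectors `(∫ w_m P_L)_m` satisfy the eigenvector equation of one tridiagonal matrix, self-adjoint for
the weights `1, 2, 2, …`, with distinct eigenvalues `-L(L+1)`; they are therefore orthogonal.
Evaluation at the pole, where only `w_0` survives, gives their norms, and the form equals `∑_L
(2L+1)/2 · ∫ P_l² P_L · W(P_L)²` (`assocSq_sum_sq`).

It remains to see that `(2L+1)/2 · ∫ P_l² P_L` is the squared Clebsch-Gordan coefficient
(`clebschGordan_sq_eq_polyInt`). The integral satisfies a two-step recursion in `L`, from the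
third-order equation of `P_l²`. Racah's sum is the coefficient of `y^l` in `(1-y)^{2l}
P_L((1+y)/(1-y))`, and its square, suitably normalised, obeys the same recursion. In particular all
terms of the expansion are non-negative, and the term `L = 0` alone is `(∫ f)²/(2l+1)`. Since `f ≥
1/2` on the cap of radius `r/2`, uniformly in `k` and `ε`, this is the lower bound. -/

/-- With `u = (X²-1)^l`, this is `(X²-1)u' = 2lXu` differentiated `n+1` times. Order `n = l + m`
yields the equation of the `m`-th derivative of `P_l`. -/
theorem iterate_derivative_sq_sub_one_pow (l n : ℕ) :
    (X ^ 2 - 1 : ℝ[X]) * derivative^[n + 2] ((X ^ 2 - 1) ^ l) +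
      2 * ((n : ℝ[X]) + 1 - (l : ℝ[X])) * X * derivative^[n + 1] ((X ^ 2 - 1) ^ l) +
      ((n : ℝ[X]) + 1) * ((n : ℝ[X]) - 2 * (l : ℝ[X])) * derivative^[n] ((X ^ 2 - 1) ^ l) = 0 := by
  induction n with
  | zero =>
    have h : (X ^ 2 - 1 : ℝ[X]) * derivative ((X ^ 2 - 1) ^ l) =
        2 * (l : ℝ[X]) * X * (X ^ 2 - 1) ^ l := by
      rcases l with _ | l
      · simp
      · simp [derivative_pow, C_ofNat]; ring
    have h2 := congrArg derivative h
    simp only [derivative_mul, derivative_X, derivative_natCast, derivative_sub, derivative_X_pow,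
      derivative_one, derivative_ofNat] at h2
    simp only [Function.iterate_succ, Function.iterate_zero, Function.comp, id, zero_add] at h2 ⊢
    simp [C_ofNat] at h2 ⊢
    linear_combination h2
  | succ n ih =>
    have h2 := congrArg derivative ih
    simp only [Function.iterate_succ_apply'] at h2 ⊢
    simp only [derivative_mul, derivative_X, derivative_natCast, derivative_sub, derivative_X_pow,
      derivative_one, derivative_ofNat, derivative_add, derivative_zero] at h2
    simp [C_ofNat] at h2 ⊢
    linear_combination h2

/-- The derivatives of the Legendre polynomial. -/
noncomputable def legendreDeriv (l m : ℕ) : ℝ[X] := derivative^[m] (legendre l)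

theorem legendreDeriv_zero (l : ℕ) : legendreDeriv l 0 = legendre l := rfl

theorem derivative_legendreDeriv (l m : ℕ) :
    derivative (legendreDeriv l m) = legendreDeriv l (m + 1) :=
  (Function.iterate_succ_apply' _ _ _).symm

theorem derivative_legendre (l : ℕ) : derivative (legendre l) = legendreDeriv l 1 := rfl

theorem legendreDeriv_eq (l m : ℕ) : legendreDeriv l m =
    C (1 / (2 ^ l * (l.factorial : ℝ))) * derivative^[l + m] ((X ^ 2 - 1) ^ l) := by
  rw [legendreDeriv, legendre, iterate_derivative_C_mul, add_comm l m, Function.iterate_add_apply]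

theorem legendreDeriv_ode (l m : ℕ) :
    (1 - X ^ 2) * legendreDeriv l (m + 2) - 2 * ((m : ℝ[X]) + 1) * X * legendreDeriv l (m + 1) +
      ((l : ℝ[X]) - (m : ℝ[X])) * ((l : ℝ[X]) + (m : ℝ[X]) + 1) * legendreDeriv l m = 0 := by
  have h := iterate_derivative_sq_sub_one_pow l (l + m)
  simp only [legendreDeriv_eq, ← add_assoc]
  push_cast at h
  linear_combination (-C (1 / (2 ^ l * (l.factorial : ℝ)))) * h

theorem legendre_zero : legendre 0 = 1 := by simp [legendre]

theorem legendre_one : legendre 1 = X := by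
  have h : derivative^[1] ((X ^ 2 - 1 : ℝ[X]) ^ 1) = C 2 * X := by
    simp; norm_num [C_ofNat]
  rw [legendre, h, ← mul_assoc, ← C_mul]
  norm_num

theorem C_two_pow_factorial (n : ℕ) :
    C (1 / (2 ^ n * (n.factorial : ℝ))) =
      C (1 / (2 ^ (n + 1) * ((n + 1).factorial : ℝ))) * (2 * ((n : ℝ[X]) + 1)) := by
  have : (2 * ((n : ℝ[X]) + 1)) = C (2 * ((n : ℝ) + 1)) := by simp [C_ofNat]
  rw [this, ← C_mul]; congr 1
  rw [Nat.factorial_succ]; push_cast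
  have := n.factorial_pos
  field_simp
  ring

/-- Rodrigues' formula with one derivative spent on the power and the rest distributed by Leibniz.
All later recursions, Bonnet's included, are combinations of this and `legendreDeriv_succ_succ_one`,
where two derivatives are spent. -/
theorem legendreDeriv_succ_one (n : ℕ) :
    legendreDeriv (n + 1) 1 = X * legendreDeriv n 1 + ((n : ℝ[X]) + 1) * legendre n := by
  have h : derivative^[n + 1 + 1] ((X ^ 2 - 1 : ℝ[X]) ^ (n + 1)) =
      2 * ((n : ℝ[X]) + 1) * (X * derivative^[n + 1] ((X ^ 2 - 1) ^ n) +
        ((n : ℝ[X]) + 1) * derivative^[n] ((X ^ 2 - 1) ^ n)) := by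
    have h1 : derivative ((X ^ 2 - 1 : ℝ[X]) ^ (n + 1)) =
        C (2 * ((n : ℝ) + 1)) * ((X ^ 2 - 1) ^ n * X) := by
      simp [derivative_pow, C_ofNat]; ring
    rw [Function.iterate_succ_apply, h1, iterate_derivative_C_mul, iterate_derivative_mul_X]
    simp only [map_mul, map_add, map_natCast, map_one, map_ofNat, nsmul_eq_mul, Nat.add_sub_cancel,
      Nat.cast_add, Nat.cast_one]
    ring
  rw [legendreDeriv_eq, legendreDeriv_eq, legendre, h, C_two_pow_factorial n]
  ring

theorem legendreDeriv_succ_succ_one (n : ℕ) :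
    legendreDeriv (n + 2) 1 = (2 * (n : ℝ[X]) + 3) * legendre (n + 1) + legendreDeriv n 1 := by
  have h : derivative^[n + 2 + 1] ((X ^ 2 - 1 : ℝ[X]) ^ (n + 2)) =
      2 * ((n : ℝ[X]) + 2) * ((2 * (n : ℝ[X]) + 3) * derivative^[n + 1] ((X ^ 2 - 1) ^ (n + 1)) +
        2 * ((n : ℝ[X]) + 1) * derivative^[n + 1] ((X ^ 2 - 1) ^ n)) := by
    have h1 : derivative^[2] ((X ^ 2 - 1 : ℝ[X]) ^ (n + 2)) =
        C (2 * ((n : ℝ) + 2) * (2 * n + 3)) * (X ^ 2 - 1) ^ (n + 1) +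
          C (4 * ((n : ℝ) + 2) * (n + 1)) * (X ^ 2 - 1) ^ n := by
      simp [derivative_pow, C_ofNat]; ring
    rw [show n + 2 + 1 = (n + 1) + 2 by ring, Function.iterate_add_apply, h1,
      iterate_map_add, iterate_derivative_C_mul, iterate_derivative_C_mul]
    simp [C_ofNat]; ring
  rw [legendreDeriv_eq, legendreDeriv_eq, legendre, h, C_two_pow_factorial n,
    C_two_pow_factorial (n + 1)]
  push_cast
  ring

theorem X_mul_legendreDeriv_succ_one (n : ℕ) :
    X * legendreDeriv (n + 1) 1 = legendreDeriv n 1 + ((n : ℝ[X]) + 1) * legendre (n + 1) := by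
  have h1 := legendreDeriv_succ_one (n + 1)
  have h2 := legendreDeriv_succ_succ_one n
  push_cast at h1
  linear_combination h2 - h1

theorem one_sub_sq_mul_legendreDeriv_one (n : ℕ) :
    (1 - X ^ 2) * legendreDeriv n 1 = ((n : ℝ[X]) + 1) * (X * legendre n - legendre (n + 1)) := by
  linear_combination X * legendreDeriv_succ_one n - X_mul_legendreDeriv_succ_one n

theorem one_sub_sq_mul_legendreDeriv_succ_one (n : ℕ) :
    (1 - X ^ 2) * legendreDeriv (n + 1) 1 =
      ((n : ℝ[X]) + 1) * (legendre n - X * legendre (n + 1)) := by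
  linear_combination -X * X_mul_legendreDeriv_succ_one n + legendreDeriv_succ_one n

/-- Bonnet's recursion. -/
theorem legendre_bonnet (n : ℕ) :
    (2 * (n : ℝ[X]) + 3) * (X * legendre (n + 1)) =
      ((n : ℝ[X]) + 2) * legendre (n + 2) + ((n : ℝ[X]) + 1) * legendre n := by
  have h := one_sub_sq_mul_legendreDeriv_one (n + 1)
  push_cast at h
  linear_combination one_sub_sq_mul_legendreDeriv_succ_one n - h

theorem one_sub_sq_mul_legendreDeriv_succ_one' (n : ℕ) :
    (2 * (n : ℝ[X]) + 3) * ((1 - X ^ 2) * legendreDeriv (n + 1) 1) =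
      ((n : ℝ[X]) + 1) * ((n : ℝ[X]) + 2) * (legendre n - legendre (n + 2)) := by
  linear_combination (2 * (n : ℝ[X]) + 3) * one_sub_sq_mul_legendreDeriv_succ_one n -
    ((n : ℝ[X]) + 1) * legendre_bonnet n

theorem legendre_eval_one (n : ℕ) : (legendre n).eval 1 = 1 := by
  induction n with
  | zero => simp [legendre_zero]
  | succ n ih =>
    have h := congrArg (eval 1) (one_sub_sq_mul_legendreDeriv_one n)
    simp [ih] at h
    have : (n : ℝ) + 1 ≠ 0 := by positivity
    rcases h with h | h
    · exact absurd h this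
    · linarith

theorem natDegree_legendre_le (n : ℕ) : (legendre n).natDegree ≤ n := by
  rw [legendre]
  refine (natDegree_C_mul_le _ _).trans ((natDegree_iterate_derivative _ _).trans ?_)
  have : ((X ^ 2 - 1 : ℝ[X]) ^ n).natDegree ≤ n * 2 :=
    natDegree_pow_le_of_le n (by compute_degree)
  omega

theorem legendre_coeff_self_ne_zero (n : ℕ) : (legendre n).coeff n ≠ 0 := by
  induction n using Nat.strong_induction_on with
  | _ n ih =>
    rcases n with _ | _ | n
    · simp [legendre_zero]
    · simp [legendre_one]
    · have h := congrArg (fun p => coeff p (n + 2)) (legendre_bonnet n)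
      have e1 : (2 * (n : ℝ[X]) + 3) = C (2 * (n : ℝ) + 3) := by simp [C_ofNat]
      have e2 : ((n : ℝ[X]) + 2) = C ((n : ℝ) + 2) := by simp [C_ofNat]
      have e3 : ((n : ℝ[X]) + 1) = C ((n : ℝ) + 1) := by simp
      rw [e1, e2, e3] at h
      simp only [coeff_add, coeff_C_mul, coeff_X_mul] at h
      rw [coeff_eq_zero_of_natDegree_lt (p := legendre n)
        (lt_of_le_of_lt (natDegree_legendre_le n) (by omega))] at h
      intro h0
      have h1 := ih (n + 1) (by omega)
      rw [show n + 1 + 1 = n + 2 by ring] at h0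
      rw [h0] at h
      simp at h
      rcases h with h | h
      · have : (0 : ℝ) < 2 * n + 3 := by positivity
        linarith
      · exact h1 h

/-- Every polynomial is a linear combination of Legendre polynomials. -/
theorem exists_legendre_expansion (N : ℕ) (p : ℝ[X]) (hp : p.natDegree ≤ N) :
    ∃ c : ℕ → ℝ, p = ∑ L ∈ Finset.range (N + 1), C (c L) * legendre L := by
  induction N generalizing p with
  | zero =>
    refine ⟨fun _ => p.coeff 0, ?_⟩
    simp [legendre_zero]
    exact eq_C_of_natDegree_le_zero hp
  | succ N ih =>
    set a := p.coeff (N + 1) / (legendre (N + 1)).coeff (N + 1) with ha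
    have hd : (p - C a * legendre (N + 1)).natDegree ≤ N := by
      rw [natDegree_le_iff_coeff_eq_zero]
      intro k hk
      rcases Nat.lt_or_ge (N + 1) k with h | h
      · rw [coeff_sub, coeff_C_mul, coeff_eq_zero_of_natDegree_lt (by omega),
          coeff_eq_zero_of_natDegree_lt (p := legendre (N + 1))
            (lt_of_le_of_lt (natDegree_legendre_le _) h)]
        simp
      · obtain rfl : k = N + 1 := by omega
        rw [coeff_sub, coeff_C_mul, ha, div_mul_cancel₀ _ (legendre_coeff_self_ne_zero _), sub_self]
    obtain ⟨c, hc⟩ := ih _ hd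
    refine ⟨fun L => if L = N + 1 then a else c L, ?_⟩
    rw [Finset.sum_range_succ]
    rw [Finset.sum_congr rfl (g := fun L => C (c L) * legendre L)]
    · rw [← hc]; simp
    · intro L hL
      rw [Finset.mem_range] at hL
      simp only [if_neg (show L ≠ N + 1 by omega)]

/-! ### Integration of polynomials over `[-1, 1]` and orthogonality -/

/-- The functional `p ↦ ∫_{-1}^1 p`. -/
noncomputable def polyInt : ℝ[X] →ₗ[ℝ] ℝ where
  toFun p := ∫ x in (-1 : ℝ)..1, p.eval x
  map_add' p q := by
    simp only [eval_add]
    exact intervalIntegral.integral_add (p.continuous.intervalIntegrable _ _)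
      (q.continuous.intervalIntegrable _ _)
  map_smul' a p := by simp [intervalIntegral.integral_const_mul]

theorem polyInt_apply (p : ℝ[X]) : polyInt p = ∫ x in (-1 : ℝ)..1, p.eval x := rfl

theorem linearMap_C_mul (Φ : ℝ[X] →ₗ[ℝ] ℝ) (a : ℝ) (p : ℝ[X]) : Φ (C a * p) = a * Φ p := by
  rw [← smul_eq_C_mul, map_smul, smul_eq_mul]

theorem polyInt_derivative (p : ℝ[X]) : polyInt (derivative p) = p.eval 1 - p.eval (-1) := by
  rw [polyInt_apply]
  exact intervalIntegral.integral_eq_sub_of_hasDerivAt (fun x _ => p.hasDerivAt x)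
    ((derivative p).continuous.intervalIntegrable _ _)

theorem polyInt_derivative_mul (p q : ℝ[X]) (h1 : p.eval 1 = 0) (h2 : p.eval (-1) = 0) :
    polyInt (derivative p * q) = -polyInt (p * derivative q) := by
  have h := polyInt_derivative (p * q)
  rw [derivative_mul, map_add] at h
  simp [h1, h2] at h
  linarith

/-- The Legendre operator `p ↦ ((1 - x²) p')'`. -/
noncomputable def legendreOp (p : ℝ[X]) : ℝ[X] := derivative ((1 - X ^ 2) * derivative p)

/-- Two integrations by parts; the factor `1 - x²` removes the boundary terms. -/
theorem polyInt_legendreOp_mul (p q : ℝ[X]) :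
    polyInt (legendreOp p * q) = polyInt (p * legendreOp q) := by
  rw [mul_comm p, legendreOp, legendreOp, polyInt_derivative_mul _ _ (by simp) (by simp),
    polyInt_derivative_mul _ _ (by simp) (by simp)]
  congr 2; ring

theorem legendreOp_legendre (L : ℕ) :
    legendreOp (legendre L) = C (-((L : ℝ) * (L + 1))) * legendre L := by
  have h := legendreDeriv_ode L 0
  rw [legendreOp, derivative_legendre, derivative_mul, derivative_legendreDeriv]
  simp at h ⊢
  rw [legendreDeriv_zero] at h
  linear_combination h

theorem polyInt_legendreOp_mul_legendre (p : ℝ[X]) (L : ℕ) :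
    polyInt (legendreOp p * legendre L) = -((L : ℝ) * (L + 1)) * polyInt (p * legendre L) := by
  rw [polyInt_legendreOp_mul, legendreOp_legendre, mul_left_comm, linearMap_C_mul]

theorem mul_succ_injective {a b : ℕ} (h : (a : ℝ) * (a + 1) = b * (b + 1)) : a = b := by
  have h' : ((a : ℝ) - b) * (a + b + 1) = 0 := by linarith
  rcases mul_eq_zero.1 h' with h | h
  · exact_mod_cast sub_eq_zero.1 h
  · have : (0 : ℝ) < a + b + 1 := by positivity
    linarith

theorem polyInt_legendre_mul_of_ne {a b : ℕ} (h : a ≠ b) :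
    polyInt (legendre a * legendre b) = 0 := by
  have h1 := polyInt_legendreOp_mul_legendre (legendre a) b
  rw [legendreOp_legendre, mul_assoc, linearMap_C_mul] at h1
  by_contra h0
  exact h (mul_succ_injective (by linarith [mul_right_cancel₀ h0 h1]))

/-- Bonnet's recursion evaluates `∫ x P_n P_{n+1}` in two ways, through the norm of `P_n` and
through that of `P_{n+1}`; comparison gives the ratio of consecutive norms. -/
theorem polyInt_legendre_sq (n : ℕ) :
    polyInt (legendre n * legendre n) = 2 / (2 * n + 1) := by
  have hb : ∀ n : ℕ, ((2 * n + 3 : ℝ)) • (X * legendre (n + 1)) =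
      ((n + 2 : ℝ)) • legendre (n + 2) + ((n + 1 : ℝ)) • legendre n := by
    intro n
    have h := legendre_bonnet n
    simp only [smul_eq_C_mul]
    simp [C_ofNat]
    exact h
  have key : ∀ n : ℕ, (2 * n + 3 : ℝ) * polyInt (legendre (n + 1) * legendre (n + 1)) =
      (2 * n + 1 : ℝ) * polyInt (legendre n * legendre n) := by
    intro n
    have h1 := congrArg (fun p => polyInt (p * legendre n)) (hb n)
    simp only [smul_mul_assoc, add_mul, map_add, map_smul, smul_eq_mul] at h1
    rw [polyInt_legendre_mul_of_ne (a := n + 2) (b := n) (by omega)] at h1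
    have h2 : (2 * n + 1 : ℝ) * polyInt (X * legendre n * legendre (n + 1)) =
        (n + 1) * polyInt (legendre (n + 1) * legendre (n + 1)) := by
      rcases n with _ | n
      · simp [legendre_zero, legendre_one]
      · have h3 := congrArg (fun p => polyInt (p * legendre (n + 2))) (hb n)
        simp only [smul_mul_assoc, add_mul, map_add, map_smul, smul_eq_mul] at h3
        rw [polyInt_legendre_mul_of_ne (a := n) (b := n + 2) (by omega)] at h3
        push_cast
        rw [show n + 1 + 1 = n + 2 by ring]
        linarith
    have e : X * legendre n * legendre (n + 1) = X * legendre (n + 1) * legendre n := by ring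
    rw [e] at h2
    have hn : (0 : ℝ) < n + 1 := by positivity
    apply mul_left_cancel₀ hn.ne'
    linear_combination (-(2 * n + 3 : ℝ)) * h2 + (2 * n + 1 : ℝ) * h1
  induction n with
  | zero => simp [legendre_zero, polyInt_apply]; norm_num
  | succ n ih =>
    have h := key n
    rw [ih] at h
    push_cast
    have : (0 : ℝ) < 2 * n + 1 := by positivity
    field_simp at h ⊢
    linarith

theorem legendre_expansion {N : ℕ} {p : ℝ[X]} (hp : p.natDegree ≤ N) :
    p = ∑ L ∈ Finset.range (N + 1),
      C ((2 * (L : ℝ) + 1) / 2 * polyInt (p * legendre L)) * legendre L := by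
  obtain ⟨c, hc⟩ := exists_legendre_expansion N p hp
  conv_lhs => rw [hc]
  refine Finset.sum_congr rfl fun L hL => ?_
  congr 2
  rw [hc, Finset.sum_mul, map_sum, Finset.sum_eq_single L]
  · rw [mul_assoc, linearMap_C_mul, polyInt_legendre_sq]
    have : (0 : ℝ) < 2 * L + 1 := by positivity
    field_simp
  · intro b _ hb
    rw [mul_assoc, linearMap_C_mul, polyInt_legendre_mul_of_ne hb, mul_zero]
  · exact fun h => absurd hL h

/-! ### The squared associated Legendre functions -/

/-- The squared normalised associated Legendre function
`(l-m)!/(l+m)! · P_{lm}(x)²`, a polynomial in `x`. -/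
noncomputable def assocSq (l m : ℕ) : ℝ[X] :=
  C (((l - m).factorial : ℝ) / (l + m).factorial) *
    ((1 - X ^ 2) ^ m * legendreDeriv l m ^ 2)

theorem assocSq_zero (l : ℕ) : assocSq l 0 = legendre l ^ 2 := by
  have := l.factorial_pos
  rw [assocSq, legendreDeriv_zero]
  simp
  rw [div_self (by positivity)]; simp

theorem natDegree_legendreDeriv_le (l m : ℕ) : (legendreDeriv l m).natDegree ≤ l - m :=
  (natDegree_iterate_derivative _ _).trans (Nat.sub_le_sub_right (natDegree_legendre_le l) m)

theorem legendreDeriv_succ_self (l : ℕ) : legendreDeriv l (l + 1) = 0 :=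
  iterate_derivative_eq_zero (Nat.lt_succ_of_le (natDegree_legendre_le l))

theorem natDegree_assocSq_le {l m : ℕ} (h : m ≤ l) : (assocSq l m).natDegree ≤ 2 * l := by
  have h1 : ((1 - X ^ 2 : ℝ[X]) ^ m).natDegree ≤ m * 2 :=
    natDegree_pow_le_of_le m (by compute_degree)
  have h2 := natDegree_pow_le_of_le 2 (natDegree_legendreDeriv_le l m)
  refine (natDegree_C_mul_le _ _).trans (natDegree_mul_le.trans ?_)
  omega

/-- The off-diagonal entries `(l-m)(l+m+1)` of the action of the Legendre operator. -/
def ladder (l m : ℕ) : ℝ := ((l : ℝ) - m) * (l + m + 1)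

theorem ladder_self (l : ℕ) : ladder l l = 0 := by simp [ladder]

theorem ladder_pos {l m : ℕ} (h : m < l) : 0 < ladder l m := by
  have : (m : ℝ) < l := by exact_mod_cast h
  have : (0 : ℝ) < l - m := by linarith
  unfold ladder; positivity

theorem factorial_ratio {l m : ℕ} (h : m < l) :
    ladder l m * (((l - (m + 1)).factorial : ℝ) / (l + (m + 1)).factorial) =
      ((l - m).factorial : ℝ) / (l + m).factorial := by
  obtain ⟨d, rfl⟩ := Nat.exists_eq_add_of_lt h
  rw [show m + d + 1 - (m + 1) = d by omega, show m + d + 1 - m = d + 1 by omega,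
    show m + d + 1 + (m + 1) = m + d + 1 + m + 1 by ring, Nat.factorial_succ d,
    Nat.factorial_succ (m + d + 1 + m)]
  have := (m + d + 1 + m).factorial_pos
  have : (0 : ℝ) < m + d + 1 + m + 1 := by positivity
  unfold ladder
  push_cast
  field_simp
  ring

theorem C_ladder (l m : ℕ) :
    C (ladder l m) = ((l : ℝ[X]) - (m : ℝ[X])) * ((l : ℝ[X]) + (m : ℝ[X]) + 1) := by
  simp [ladder]

theorem ladder_mul_assocSq_succ {l m : ℕ} (h : m ≤ l) :
    C (ladder l m) * assocSq l (m + 1) =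
      C (((l - m).factorial : ℝ) / (l + m).factorial) *
        ((1 - X ^ 2) ^ (m + 1) * legendreDeriv l (m + 1) ^ 2) := by
  rcases h.lt_or_eq with h | rfl
  · rw [assocSq, ← mul_assoc, ← C_mul, factorial_ratio h]
  · rw [legendreDeriv_succ_self, ladder_self]; simp

theorem ladder_mul_assocSq {l m : ℕ} (h : m < l) :
    C (ladder l m) * assocSq l m =
      C (((l - (m + 1)).factorial : ℝ) / (l + (m + 1)).factorial) *
        ((1 - X ^ 2) ^ m * (C (ladder l m) * legendreDeriv l m) ^ 2) := by
  rw [assocSq, ← factorial_ratio h, C_mul]; ring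

/-- Legendre's equation removes the second derivative: the image of `P_l²` is `2(1-x²)P_l'² -
2l(l+1)P_l²`, and the first summand is a multiple of `w_1`. -/
theorem legendreOp_assocSq_zero (l : ℕ) :
    legendreOp (assocSq l 0) =
      C (-2 * ((l : ℝ) * (l + 1))) * assocSq l 0 + C (2 * ladder l 0) * assocSq l 1 := by
  rw [C_mul (a := 2), mul_assoc (C 2), ladder_mul_assocSq_succ (Nat.zero_le l), assocSq_zero,
    legendreOp, derivative_pow, derivative_legendre, derivative_mul, derivative_mul,
    derivative_mul, derivative_legendreDeriv]
  have h := legendreDeriv_ode l 0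
  have hf : (l.factorial : ℝ) / l.factorial = 1 := div_self (by positivity)
  simp [derivative_legendre, C_ofNat, hf, legendreDeriv_zero] at h ⊢
  linear_combination (2 * legendre l) * h

/-- The equation of order `m + 1` removes the third-highest derivative `P_l^{(m+3)}`. That of order
`m` writes `ladder l m * P_l^{(m)}` through the next two derivatives, and the square of that
relation matches the remaining terms. -/
theorem legendreOp_assocSq_succ {l m : ℕ} (h : m < l) :
    legendreOp (assocSq l (m + 1)) =
      C (-2 * ((l : ℝ) * (l + 1)) + 2 * (m + 1) ^ 2) * assocSq l (m + 1) +
        C (ladder l (m + 1)) * assocSq l (m + 2) + C (ladder l m) * assocSq l m := by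
  rw [ladder_mul_assocSq_succ h, ladder_mul_assocSq h]
  have h0 : C (ladder l m) * legendreDeriv l m = 2 * ((m : ℝ[X]) + 1) * X * legendreDeriv l (m + 1)
      - (1 - X ^ 2) * legendreDeriv l (m + 2) := by
    rw [C_ladder]; linear_combination legendreDeriv_ode l m
  have h1 := legendreDeriv_ode l (m + 1)
  rw [h0, assocSq, legendreOp]
  set k := ((l - (m + 1)).factorial : ℝ) / (l + (m + 1)).factorial
  have hs : derivative ((1 - X ^ 2 : ℝ[X]) ^ (m + 1)) =
      -(2 * ((m : ℝ[X]) + 1) * X * (1 - X ^ 2) ^ m) := by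
    simp [derivative_pow, C_ofNat]; ring
  have e1 : (1 - X ^ 2) * derivative (C k * ((1 - X ^ 2) ^ (m + 1) * legendreDeriv l (m + 1) ^ 2)) =
      C k * ((1 - X ^ 2) ^ (m + 1) * (-(2 * ((m : ℝ[X]) + 1) * X * legendreDeriv l (m + 1) ^ 2) +
        2 * ((1 - X ^ 2) * (legendreDeriv l (m + 1) * legendreDeriv l (m + 2))))) := by
    rw [derivative_C_mul, derivative_mul, hs, derivative_pow, derivative_legendreDeriv]
    simp [C_ofNat]; ring
  rw [e1, derivative_C_mul, derivative_mul, hs]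
  push_cast at h1
  simp [derivative_pow, derivative_legendreDeriv, C_ofNat]
  linear_combination (2 * C k * (1 - X ^ 2) ^ (m + 1) * legendreDeriv l (m + 1)) * h1

/-- Summation by parts for the tridiagonal action of the Legendre operator. -/
theorem ladder_wronskian (l : ℕ) (v v' : ℕ → ℝ) (κ κ' : ℝ)
    (h0 : κ * v 0 = -2 * ((l : ℝ) * (l + 1)) * v 0 + 2 * ladder l 0 * v 1)
    (h0' : κ' * v' 0 = -2 * ((l : ℝ) * (l + 1)) * v' 0 + 2 * ladder l 0 * v' 1)
    (h : ∀ m < l, κ * v (m + 1) = (-2 * ((l : ℝ) * (l + 1)) + 2 * (m + 1) ^ 2) * v (m + 1) +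
      ladder l (m + 1) * v (m + 2) + ladder l m * v m)
    (h' : ∀ m < l, κ' * v' (m + 1) = (-2 * ((l : ℝ) * (l + 1)) + 2 * (m + 1) ^ 2) * v' (m + 1) +
      ladder l (m + 1) * v' (m + 2) + ladder l m * v' m) (M : ℕ) (hM : M ≤ l) :
    (κ - κ') * (v 0 * v' 0 + 2 * ∑ m ∈ Finset.range M, v (m + 1) * v' (m + 1)) =
      2 * (ladder l M * (v (M + 1) * v' M - v M * v' (M + 1))) := by
  induction M with
  | zero => simp; linear_combination v' 0 * h0 - v 0 * h0'
  | succ M ih =>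
    rw [Finset.sum_range_succ]
    linear_combination ih (by omega) + 2 * v' (M + 1) * h M hM - 2 * v (M + 1) * h' M hM

theorem polyInt_assocSq_mul_legendre_zero (l L : ℕ) :
    -((L : ℝ) * (L + 1)) * polyInt (assocSq l 0 * legendre L) =
      -2 * ((l : ℝ) * (l + 1)) * polyInt (assocSq l 0 * legendre L) +
        2 * ladder l 0 * polyInt (assocSq l 1 * legendre L) := by
  rw [← polyInt_legendreOp_mul_legendre, legendreOp_assocSq_zero, add_mul, map_add, mul_assoc,
    mul_assoc, linearMap_C_mul, linearMap_C_mul]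

theorem polyInt_assocSq_mul_legendre_succ (l L m : ℕ) (h : m < l) :
    -((L : ℝ) * (L + 1)) * polyInt (assocSq l (m + 1) * legendre L) =
      (-2 * ((l : ℝ) * (l + 1)) + 2 * (m + 1) ^ 2) * polyInt (assocSq l (m + 1) * legendre L) +
        ladder l (m + 1) * polyInt (assocSq l (m + 2) * legendre L) +
        ladder l m * polyInt (assocSq l m * legendre L) := by
  rw [← polyInt_legendreOp_mul_legendre, legendreOp_assocSq_succ h, add_mul, add_mul, map_add,
    map_add, mul_assoc, mul_assoc, mul_assoc, linearMap_C_mul, linearMap_C_mul, linearMap_C_mul]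

/-- Eigenvectors of a self-adjoint tridiagonal matrix for distinct eigenvalues. The boundary term of
`ladder_wronskian` vanishes at `M = l` because `ladder l l = 0`. -/
theorem polyInt_assocSq_orthogonal (l : ℕ) {L L' : ℕ} (h : L ≠ L') :
    polyInt (assocSq l 0 * legendre L) * polyInt (assocSq l 0 * legendre L') +
      2 * ∑ m ∈ Finset.range l, polyInt (assocSq l (m + 1) * legendre L) *
        polyInt (assocSq l (m + 1) * legendre L') = 0 := by
  have hw := ladder_wronskian l (fun m => polyInt (assocSq l m * legendre L))
    (fun m => polyInt (assocSq l m * legendre L')) _ _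
    (polyInt_assocSq_mul_legendre_zero l L) (polyInt_assocSq_mul_legendre_zero l L')
    (polyInt_assocSq_mul_legendre_succ l L) (polyInt_assocSq_mul_legendre_succ l L') l le_rfl
  rw [ladder_self, zero_mul, mul_zero] at hw
  refine (mul_eq_zero.1 hw).resolve_left fun h0 => h (mul_succ_injective ?_)
  linarith

/-- At `L = 0` the tridiagonal relation says that the flux `ladder l m * (I_{m+1} - I_m)` of `I_m =
∫ w_m` does not depend on `m`, and it is zero at `m = 0`. So all `I_m` equal `∫ P_l²`. -/
theorem polyInt_assocSq (l m : ℕ) (h : m ≤ l) : polyInt (assocSq l m) = 2 / (2 * l + 1) := by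
  have hstep : ∀ m, m ≤ l → ladder l m * (polyInt (assocSq l (m + 1)) - polyInt (assocSq l m)) = 0
      := by
    intro m hm
    induction m with
    | zero =>
      have h := polyInt_assocSq_mul_legendre_zero l 0
      simp [legendre_zero, ladder] at h ⊢
      by_cases hl : l = 0
      · simp [hl]
      · have : (l : ℝ) * (l + 1) ≠ 0 := by positivity
        right
        apply mul_left_cancel₀ this
        linarith
    | succ m ih =>
      have h := polyInt_assocSq_mul_legendre_succ l 0 m hm
      have h2 := ih (by omega)
      simp [legendre_zero] at h
      have e : -2 * ((l : ℝ) * (l + 1)) + 2 * (m + 1) ^ 2 = -ladder l (m + 1) - ladder l m := by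
        simp [ladder]; ring
      linear_combination h2 - h - polyInt (assocSq l (m + 1)) * e
  induction m with
  | zero => rw [assocSq_zero, sq, polyInt_legendre_sq]
  | succ m ih =>
    have h1 := (mul_eq_zero.1 (hstep m (by omega))).resolve_left (ladder_pos h).ne'
    rw [← ih (by omega)]
    linarith

theorem assocSq_eval_one_succ (l m : ℕ) : (assocSq l (m + 1)).eval 1 = 0 := by
  simp [assocSq]

/-- Each `w_m` has degree at most `2l`, so it is a finite Legendre series; in the resulting double
sum over `L, L'` the orthogonality in `m` leaves only the diagonal. Two independent functionals are
kept so that one of them can be a point evaluation. -/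
theorem assocSq_bilinear (l : ℕ) (Φ Ψ : ℝ[X] →ₗ[ℝ] ℝ) :
    Φ (assocSq l 0) * Ψ (assocSq l 0) +
      2 * ∑ m ∈ Finset.range l, Φ (assocSq l (m + 1)) * Ψ (assocSq l (m + 1)) =
    ∑ L ∈ Finset.range (2 * l + 1), ((2 * (L : ℝ) + 1) / 2) ^ 2 *
      (polyInt (assocSq l 0 * legendre L) ^ 2 +
        2 * ∑ m ∈ Finset.range l, polyInt (assocSq l (m + 1) * legendre L) ^ 2) *
      (Φ (legendre L) * Ψ (legendre L)) := by
  have hexp : ∀ (Θ : ℝ[X] →ₗ[ℝ] ℝ) (m : ℕ), m ≤ l → Θ (assocSq l m) =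
      ∑ L ∈ Finset.range (2 * l + 1),
        (2 * (L : ℝ) + 1) / 2 * Θ (legendre L) * polyInt (assocSq l m * legendre L) := by
    intro Θ m hm
    conv_lhs => rw [legendre_expansion (natDegree_assocSq_le hm), map_sum]
    refine Finset.sum_congr rfl fun L _ => ?_
    rw [linearMap_C_mul]; ring
  rw [hexp Φ 0 (Nat.zero_le _), hexp Ψ 0 (Nat.zero_le _)]
  have hs : ∑ m ∈ Finset.range l, Φ (assocSq l (m + 1)) * Ψ (assocSq l (m + 1)) =
      ∑ m ∈ Finset.range l, (∑ L ∈ Finset.range (2 * l + 1),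
        (2 * (L : ℝ) + 1) / 2 * Φ (legendre L) * polyInt (assocSq l (m + 1) * legendre L)) *
        (∑ L ∈ Finset.range (2 * l + 1),
        (2 * (L : ℝ) + 1) / 2 * Ψ (legendre L) * polyInt (assocSq l (m + 1) * legendre L)) := by
    refine Finset.sum_congr rfl fun m hm => ?_
    rw [Finset.mem_range] at hm
    rw [hexp Φ (m + 1) hm, hexp Ψ (m + 1) hm]
  rw [hs]
  simp only [Finset.sum_mul_sum]
  rw [Finset.sum_comm (s := Finset.range l), Finset.mul_sum, ← Finset.sum_add_distrib]
  refine Finset.sum_congr rfl fun L hL => ?_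
  rw [Finset.sum_comm (s := Finset.range l), Finset.mul_sum, ← Finset.sum_add_distrib,
    Finset.sum_eq_single L]
  · rw [mul_add, add_mul]
    congr 1
    · ring
    · rw [Finset.mul_sum, Finset.mul_sum, Finset.mul_sum, Finset.sum_mul]
      refine Finset.sum_congr rfl fun m _ => ?_
      ring
  · intro L' _ hne
    have h := polyInt_assocSq_orthogonal l hne.symm
    rw [Finset.sum_congr rfl (g := fun m => ((2 * (L : ℝ) + 1) / 2 * Φ (legendre L) *
      ((2 * (L' : ℝ) + 1) / 2 * Ψ (legendre L'))) * (polyInt (assocSq l (m + 1) * legendre L) *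
        polyInt (assocSq l (m + 1) * legendre L'))) (fun m _ => by ring), ← Finset.mul_sum]
    linear_combination ((2 * (L : ℝ) + 1) / 2 * Φ (legendre L) *
      ((2 * (L' : ℝ) + 1) / 2 * Ψ (legendre L'))) * h
  · exact fun h => absurd hL h

/-- The diagonal form, in Legendre polynomials, of the kernel `∑_m w_m(s) w_m(t)`. -/
theorem assocSq_sum_sq (l : ℕ) (Φ : ℝ[X] →ₗ[ℝ] ℝ) :
    Φ (assocSq l 0) ^ 2 + 2 * ∑ m ∈ Finset.range l, Φ (assocSq l (m + 1)) ^ 2 =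
    ∑ L ∈ Finset.range (2 * l + 1),
      (2 * (L : ℝ) + 1) / 2 * polyInt (legendre l ^ 2 * legendre L) * Φ (legendre L) ^ 2 := by
  have hN : ∀ L ∈ Finset.range (2 * l + 1), ((2 * (L : ℝ) + 1) / 2) ^ 2 *
      (polyInt (assocSq l 0 * legendre L) ^ 2 +
        2 * ∑ m ∈ Finset.range l, polyInt (assocSq l (m + 1) * legendre L) ^ 2) =
      (2 * (L : ℝ) + 1) / 2 * polyInt (legendre l ^ 2 * legendre L) := by
    intro L hL
    -- At the pole `w_m(1)` is `1` for `m = 0` and `0` otherwise, while every `P_L(1) = 1`. Pairing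
    -- with `∫ · P_L` thus isolates the norm of the `L`-th vector.
    have h := assocSq_bilinear l (polyInt ∘ₗ LinearMap.mulRight ℝ (legendre L)) (leval 1)
    simp [assocSq_eval_one_succ, assocSq_zero, legendre_eval_one] at h
    rw [Finset.sum_eq_single L, polyInt_legendre_sq] at h
    · rw [assocSq_zero]
      have hne : (2 * (L : ℝ) + 1) ≠ 0 := by positivity
      have e : ∀ a S : ℝ, a ≠ 0 → (a / 2) ^ 2 * S = a / 2 * ((a / 2) ^ 2 * S * (2 / a)) := by
        intro a S ha; field_simp
      exact (e _ _ hne).trans (by rw [← h])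
    · intro b _ hb
      rw [polyInt_legendre_mul_of_ne hb, mul_zero]
    · exact fun h => absurd hL h
  have h := assocSq_bilinear l Φ Φ
  simp only [← sq] at h
  rw [h]
  exact Finset.sum_congr rfl fun L hL => by rw [hN L hL]

/-! ### Integrals of triple products of Legendre polynomials -/

/-- The third-order equation of `P_l²`, the symmetric square of Legendre's equation. The expression
under the derivative is `2((1-x²)P_l')²`, and `((1-x²)P_l')' = -l(l+1)P_l`. -/
theorem derivative_legendreOp_sq (l : ℕ) :
    derivative ((1 - X ^ 2) * (legendreOp (legendre l ^ 2) +
      C (2 * ((l : ℝ) * (l + 1))) * legendre l ^ 2)) =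
    C (-2 * ((l : ℝ) * (l + 1))) * ((1 - X ^ 2) * derivative (legendre l ^ 2)) := by
  have h := legendreDeriv_ode l 0
  rw [legendreDeriv_zero] at h
  have e : (1 - X ^ 2) * (legendreOp (legendre l ^ 2) +
      C (2 * ((l : ℝ) * (l + 1))) * legendre l ^ 2) =
      C 2 * ((1 - X ^ 2) * legendreDeriv l 1) ^ 2 := by
    rw [legendreOp, derivative_pow, derivative_legendre, derivative_mul, derivative_mul,
      derivative_mul, derivative_legendreDeriv]
    simp [derivative_legendre, C_ofNat] at h ⊢
    linear_combination (2 * (1 - X ^ 2) * legendre l) * h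
  rw [e, derivative_C_mul, derivative_pow, derivative_pow, derivative_legendre, derivative_mul,
    derivative_legendreDeriv]
  simp [C_ofNat] at h ⊢
  linear_combination (4 * (1 - X ^ 2) * legendreDeriv l 1) * h

/-- Weak form of the third-order equation, tested against `q`. -/
theorem polyInt_legendreOp_sq (l : ℕ) (q : ℝ[X]) :
    polyInt ((1 - X ^ 2) * derivative q * legendreOp (legendre l ^ 2)) +
      2 * ((l : ℝ) * (l + 1)) * polyInt ((1 - X ^ 2) * derivative q * legendre l ^ 2) +
      2 * ((l : ℝ) * (l + 1)) * polyInt (derivative ((1 - X ^ 2) * q) * legendre l ^ 2) = 0 := by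
  have h := polyInt_derivative_mul ((1 - X ^ 2) * (legendreOp (legendre l ^ 2) +
      C (2 * ((l : ℝ) * (l + 1))) * legendre l ^ 2)) q (by simp) (by simp)
  have h2 := polyInt_derivative_mul ((1 - X ^ 2) * q) (legendre l ^ 2) (by simp) (by simp)
  rw [derivative_legendreOp_sq, mul_assoc, linearMap_C_mul] at h
  rw [h2]
  have e1 : (1 - X ^ 2) * derivative (legendre l ^ 2) * q =
    (1 - X ^ 2) * q * derivative (legendre l ^ 2) := by ring
  have e2 : (1 - X ^ 2) * (legendreOp (legendre l ^ 2) +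
      C (2 * ((l : ℝ) * (l + 1))) * legendre l ^ 2) * derivative q =
      (1 - X ^ 2) * derivative q * legendreOp (legendre l ^ 2) +
      C (2 * ((l : ℝ) * (l + 1))) * ((1 - X ^ 2) * derivative q * legendre l ^ 2) := by ring
  rw [e1, e2, map_add, linearMap_C_mul] at h
  linarith

theorem polyInt_sq_mul_legendre_one {l : ℕ} (hl : 1 ≤ l) :
    polyInt (legendre l ^ 2 * legendre 1) = 0 := by
  have h := polyInt_legendreOp_sq l 1
  have e : derivative ((1 - X ^ 2) * 1 : ℝ[X]) * legendre l ^ 2 =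
      C (-2) * (legendre l ^ 2 * legendre 1) := by
    simp [legendre_one, C_ofNat]; ring
  rw [e, linearMap_C_mul] at h
  simp at h
  have : l ≠ 0 := by omega
  have h3 : (l : ℝ) + 1 ≠ 0 := by positivity
  tauto

theorem one_sub_sq_mul_derivative_legendre_succ (n : ℕ) :
    (1 - X ^ 2) * derivative (legendre (n + 1)) =
      C (((n : ℝ) + 1) / (2 * n + 3) * (n + 2)) * (legendre n - legendre (n + 2)) := by
  have hpos : (0 : ℝ) < 2 * n + 3 := by positivity
  have h0 := one_sub_sq_mul_legendreDeriv_succ_one' n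
  have hc : (2 * (n : ℝ[X]) + 3) = C (2 * (n : ℝ) + 3) := by simp [C_ofNat]
  have hc2 : ((n : ℝ[X]) + 1) * ((n : ℝ[X]) + 2) = C (((n : ℝ) + 1) * (n + 2)) := by
    simp [C_ofNat]
  rw [hc, hc2] at h0
  have h1 := congrArg (fun p => C (1 / (2 * (n : ℝ) + 3)) * p) h0
  simp only [← mul_assoc, ← C_mul] at h1
  rw [one_div_mul_cancel hpos.ne', C_1, one_mul, one_div_mul_eq_div] at h1
  exact h1

theorem X_mul_legendre_succ (n : ℕ) :
    X * legendre (n + 1) = C (((n : ℝ) + 2) / (2 * n + 3)) * legendre (n + 2) +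
      C (((n : ℝ) + 1) / (2 * n + 3)) * legendre n := by
  have hpos : (0 : ℝ) < 2 * n + 3 := by positivity
  have h0 := legendre_bonnet n
  have hc : (2 * (n : ℝ[X]) + 3) = C (2 * (n : ℝ) + 3) := by simp [C_ofNat]
  have hc2 : ((n : ℝ[X]) + 2) = C ((n : ℝ) + 2) := by simp [C_ofNat]
  have hc1 : ((n : ℝ[X]) + 1) = C ((n : ℝ) + 1) := by simp
  rw [hc, hc1, hc2] at h0
  have h1 := congrArg (fun p => C (1 / (2 * (n : ℝ) + 3)) * p) h0
  simp only [mul_add] at h1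
  simp only [← mul_assoc, ← C_mul] at h1
  rw [one_div_mul_cancel hpos.ne', C_1, one_mul, one_div_mul_eq_div, one_div_mul_eq_div] at h1
  exact h1

/-- The weak equation with `q = P_{n+1}`: both `(1-x²)P_{n+1}'` and `xP_{n+1}` are combinations of
`P_n` and `P_{n+2}`, on which the Legendre operator acts by its eigenvalues. -/
theorem polyInt_sq_mul_legendre_add_two (l n : ℕ) :
    ((n : ℝ) + 2) ^ 2 * ((2 * l + 1) ^ 2 - (n + 2) ^ 2) *
        polyInt (legendre l ^ 2 * legendre (n + 2)) =
      ((n : ℝ) + 1) ^ 2 * ((2 * l + 1) ^ 2 - (n + 1) ^ 2) *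
        polyInt (legendre l ^ 2 * legendre n) := by
  have h := polyInt_legendreOp_sq l (legendre (n + 1))
  have hpos : (0 : ℝ) < 2 * n + 3 := by positivity
  have e3 : derivative ((1 - X ^ 2) * legendre (n + 1)) =
      (1 - X ^ 2) * derivative (legendre (n + 1)) - C 2 * (X * legendre (n + 1)) := by
    rw [derivative_mul]; simp [C_ofNat]; ring
  rw [e3, X_mul_legendre_succ, one_sub_sq_mul_derivative_legendre_succ] at h
  have c0 : ∀ (a : ℝ) (p : ℝ[X]), polyInt (C a * (legendre n - legendre (n + 2)) * p) =
      a * (polyInt (p * legendre n) - polyInt (p * legendre (n + 2))) := by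
    intro a p
    rw [mul_assoc, linearMap_C_mul, sub_mul, map_sub, mul_comm p, mul_comm p]
  simp only [sub_mul (c := legendre l ^ 2), map_sub, c0, polyInt_legendreOp_mul_legendre] at h
  have c1 : ∀ a b : ℝ, polyInt (C 2 * (C a * legendre (n + 2) + C b * legendre n) * legendre l ^ 2)
      = 2 * (a * polyInt (legendre l ^ 2 * legendre (n + 2)) +
        b * polyInt (legendre l ^ 2 * legendre n)) := by
    intro a b
    rw [mul_assoc, linearMap_C_mul, add_mul, map_add, mul_assoc, mul_assoc, linearMap_C_mul,
      linearMap_C_mul, mul_comm (legendre l ^ 2), mul_comm (legendre l ^ 2)]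
  rw [c1] at h
  push_cast at h
  field_simp at h
  linear_combination -h

/-! ### The coefficients `C_{l0l0}^{L0}` -/

/-- The coefficient of `(1 - x²)^l` when `x ^ j` is expanded in the products
`(1 - x)^a (1 + x)^(2l - a)`, up to normalisation. -/
noncomputable def middleCoeffPow (l j : ℕ) : ℝ :=
  ((1 - X : ℝ[X]) ^ (2 * l - j) * (1 + X) ^ j).coeff l

/-- The linear functional with `x ^ j ↦ middleCoeffPow l j`. -/
noncomputable def middleCoeff (l : ℕ) : ℝ[X] →ₗ[ℝ] ℝ :=
  Polynomial.lsum fun j => LinearMap.mulRight ℝ (middleCoeffPow l j)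

theorem middleCoeff_monomial (l j : ℕ) (a : ℝ) :
    middleCoeff l (monomial j a) = a * middleCoeffPow l j := by
  simp [middleCoeff, Polynomial.lsum_apply, sum_monomial_index]

theorem middleCoeff_X_pow (l j : ℕ) : middleCoeff l (X ^ j) = middleCoeffPow l j := by
  rw [← monomial_one_right_eq_X_pow, middleCoeff_monomial, one_mul]

/-- The operator `y d/dy - l` annihilates the coefficient of `y^l`. Applied to `(1-y)^{2l-j}(1+y)^j`
and multiplied by `-2`, it produces this combination. For `j = 0` the truncated `j - 1` is harmless,
its factor being zero. -/
theorem middleCoeffPow_rec {l j : ℕ} (h : j + 1 ≤ 2 * l) :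
    (j : ℝ) * middleCoeffPow l (j - 1) + (2 * l - j) * middleCoeffPow l (j + 1) = 0 := by
  obtain ⟨d, hd⟩ := Nat.exists_eq_add_of_le h
  have hd' : (2 * (l : ℝ)) = j + 1 + d := by exact_mod_cast hd
  set B : ℝ[X] := derivative ((1 + X) ^ j) with hB
  have hB1 : (1 + X) * B = (j : ℝ[X]) * (1 + X) ^ j := by
    rcases j with _ | j
    · simp [hB]
    · simp [hB, derivative_pow]; ring
  have hq : ((X : ℝ[X]) * derivative ((1 - X) ^ (d + 1) * (1 + X) ^ j) -
      C (l : ℝ) * ((1 - X) ^ (d + 1) * (1 + X) ^ j)).coeff l = 0 := by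
    rw [coeff_sub, coeff_C_mul]
    rcases l with _ | l
    · simp
    · rw [coeff_X_mul, coeff_derivative]; push_cast; ring
  have h1 : (j : ℝ) * middleCoeffPow l (j - 1) = ((1 - X) ^ (d + 2) * B).coeff l := by
    rcases j with _ | j
    · simp [hB]
    · rw [middleCoeffPow, ← coeff_C_mul, show 2 * l - (j + 1 - 1) = d + 2 by omega]
      congr 1
      simp [hB, derivative_pow]; ring
  rw [h1, middleCoeffPow, show 2 * l - (j + 1) = d by omega, ← coeff_C_mul, ← coeff_add,
    ← mul_zero (-2 : ℝ), ← hq, ← coeff_C_mul]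
  congr 1
  have hC : 2 * C (l : ℝ) = (j : ℝ[X]) + 1 + (d : ℝ[X]) := by
    rw [← C_ofNat, ← C_mul, hd']; simp
  have hC2 : C (2 * (l : ℝ) - j) = (d : ℝ[X]) + 1 := by
    rw [hd', show (j : ℝ) + 1 + d - j = d + 1 by ring]; simp
  rw [hC2, derivative_mul, ← hB]
  simp [derivative_pow, C_ofNat]
  simp at hC
  linear_combination (1 - X) ^ (d + 1) * hB1 - (1 - X) ^ (d + 1) * (1 + X) ^ j * hC

/-- Linear extension of `middleCoeffPow_rec`: for `p = x^j` the argument is `j x^{j-1} + (2l-j)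
x^{j+1}`. With `p = P_{n+1}` it gives a two-step recursion for the values at Legendre polynomials.
-/
theorem middleCoeff_killed (l : ℕ) (p : ℝ[X]) (hp : p.natDegree + 1 ≤ 2 * l) :
    middleCoeff l ((1 - X ^ 2) * derivative p + C (2 * (l : ℝ)) * (X * p)) = 0 := by
  conv_lhs => rw [p.as_sum_range_C_mul_X_pow]
  simp only [Finset.mul_sum, ← Finset.sum_add_distrib, map_sum]
  refine Finset.sum_eq_zero fun j hj => ?_
  rw [Finset.mem_range] at hj
  have e : (1 - X ^ 2) * derivative (C (p.coeff j) * X ^ j) +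
      C (2 * (l : ℝ)) * (X * (C (p.coeff j) * X ^ j)) =
      C (p.coeff j) * (C (j : ℝ) * X ^ (j - 1) + C (2 * (l : ℝ) - j) * X ^ (j + 1)) := by
    rcases j with _ | j
    · simp; ring
    · simp; ring
  rw [e, linearMap_C_mul, map_add, linearMap_C_mul, linearMap_C_mul, middleCoeff_X_pow,
    middleCoeff_X_pow, middleCoeffPow_rec (by omega), mul_zero]

theorem middleCoeff_legendre_one {l : ℕ} (hl : 1 ≤ l) : middleCoeff l (legendre 1) = 0 := by
  have h := middleCoeff_killed l 1 (by simp; omega)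
  rw [map_add, linearMap_C_mul] at h
  have : l ≠ 0 := by omega
  simpa [legendre_one, this] using h

theorem middleCoeff_legendre_add_two {l n : ℕ} (h : n + 2 ≤ 2 * l) :
    ((n : ℝ) + 2) * (2 * l - n - 1) * middleCoeff l (legendre (n + 2)) =
      -(((n : ℝ) + 1) * (2 * l + n + 2) * middleCoeff l (legendre n)) := by
  have h := middleCoeff_killed l (legendre (n + 1)) (by
    have := natDegree_legendre_le (n + 1); omega)
  have hpos : (0 : ℝ) < 2 * n + 3 := by positivity
  rw [X_mul_legendre_succ, one_sub_sq_mul_derivative_legendre_succ, map_add, linearMap_C_mul,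
    linearMap_C_mul, map_add, map_sub, linearMap_C_mul, linearMap_C_mul] at h
  field_simp at h
  linear_combination h

/-- The substitution `x = (1 + y) / (1 - y)`, made polynomial by the factor `(1 - y) ^ N`. -/
noncomputable def cayley (N : ℕ) (p : ℝ[X]) : ℝ[X] :=
  ∑ j ∈ Finset.range (N + 1), C (p.coeff j) * ((1 - X) ^ (N - j) * (1 + X) ^ j)

theorem cayley_eval {N : ℕ} {p : ℝ[X]} (hp : p.natDegree ≤ N) {y : ℝ} (hy : y ≠ 1) :
    (cayley N p).eval y = (1 - y) ^ N * p.eval ((1 + y) / (1 - y)) := by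
  have hy' : 1 - y ≠ 0 := sub_ne_zero.2 hy.symm
  rw [eval_eq_sum_range' (Nat.lt_succ_of_le hp), Finset.mul_sum, cayley, eval_finsetSum]
  refine Finset.sum_congr rfl fun j hj => ?_
  have hj' : j ≤ N := Nat.lt_succ_iff.1 (Finset.mem_range.1 hj)
  simp only [eval_mul, eval_C, eval_pow, eval_sub, eval_add, eval_one, eval_X]
  rw [div_pow, ← Nat.sub_add_cancel hj', pow_add, Nat.add_sub_cancel]
  field_simp

theorem middleCoeff_eq_coeff {l : ℕ} {p : ℝ[X]} (hp : p.natDegree ≤ 2 * l) :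
    middleCoeff l p = (cayley (2 * l) p).coeff l := by
  conv_lhs => rw [p.as_sum_range' (2 * l + 1) (Nat.lt_succ_of_le hp)]
  simp only [map_sum, middleCoeff_monomial, cayley, finsetSum_coeff, coeff_C_mul,
    middleCoeffPow]

theorem eq_of_eval_eq_of_ne_one {p q : ℝ[X]} (h : ∀ y : ℝ, y ≠ 1 → p.eval y = q.eval y) :
    p = q :=
  Polynomial.eq_of_infinite_eval_eq p q
    (((Set.finite_singleton (1 : ℝ)).infinite_compl).mono fun y hy => h y hy)

theorem coeff_one_sub_X_pow (n j : ℕ) :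
    ((1 - X : ℝ[X]) ^ n).coeff j = (-1) ^ j * (n.choose j : ℝ) := by
  have h : (1 - X : ℝ[X]) = 1 + C (-1) * X := by simp; ring
  rw [h, add_comm, add_pow, finsetSum_coeff]
  simp only [one_pow, mul_one, mul_pow, ← C_pow, mul_assoc, coeff_C_mul, ← C_eq_natCast]
  simp only [coeff_X_pow_mul', coeff_C]
  rw [Finset.sum_eq_single j]
  · simp
  · intro b _ hb
    rcases Nat.lt_or_ge j b with h | h
    · simp [Nat.not_le.2 h]
    · have : j - b ≠ 0 := by omega
      simp [this]
  · intro h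
    simp at h
    simp [Nat.choose_eq_zero_of_lt h]

/-- Under `x = (1+y)/(1-y)` one has `x - 1 = 2y/(1-y)` and `x + 1 = 2/(1-y)`, so the product becomes
`2^L y^k (1-y)^{2l-L}`, whose coefficient of `y^l` is a signed binomial. -/
theorem middleCoeff_factors {l L k : ℕ} (hL : L ≤ 2 * l) (hk : k ≤ L) :
    middleCoeff l ((X - 1) ^ k * (X + 1) ^ (L - k)) =
      2 ^ L * if k ≤ l then (-1) ^ (l - k) * ((2 * l - L).choose (l - k) : ℝ) else 0 := by
  have hd : ((X - 1 : ℝ[X]) ^ k * (X + 1) ^ (L - k)).natDegree ≤ 2 * l := by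
    have h1 : ((X - 1 : ℝ[X]) ^ k).natDegree ≤ k * 1 := natDegree_pow_le_of_le k (by compute_degree)
    have h2 : ((X + 1 : ℝ[X]) ^ (L - k)).natDegree ≤ (L - k) * 1 :=
      natDegree_pow_le_of_le _ (by compute_degree)
    refine natDegree_mul_le.trans ?_
    omega
  have e : cayley (2 * l) ((X - 1) ^ k * (X + 1) ^ (L - k)) =
      C (2 ^ L) * (X ^ k * (1 - X) ^ (2 * l - L)) := by
    refine eq_of_eval_eq_of_ne_one fun y hy => ?_
    have hy' : 1 - y ≠ 0 := sub_ne_zero.2 hy.symm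
    rw [cayley_eval hd hy]
    simp only [eval_mul, eval_C, eval_pow, eval_sub, eval_add, eval_one, eval_X]
    have e1 : (1 + y) / (1 - y) - 1 = 2 * y / (1 - y) := by field_simp; ring
    have e2 : (1 + y) / (1 - y) + 1 = 2 / (1 - y) := by field_simp; ring
    rw [e1, e2, div_pow, div_pow, mul_pow]
    obtain ⟨d, rfl⟩ := Nat.exists_eq_add_of_le hk
    obtain ⟨e, he⟩ := Nat.exists_eq_add_of_le hL
    rw [he, Nat.add_sub_cancel_left, Nat.add_sub_cancel_left, pow_add, pow_add, pow_add]
    field_simp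
  rw [middleCoeff_eq_coeff hd, e, coeff_C_mul, coeff_X_pow_mul']
  simp only [coeff_one_sub_X_pow]

/-- Leibniz' rule in Rodrigues' formula for `(x-1)^L (x+1)^L`. It makes `middleCoeff l (legendre L)`
an alternating sum of binomials of the same shape as Racah's. -/
theorem legendre_eq_sum (L : ℕ) :
    legendre L = C (1 / 2 ^ L) * ∑ k ∈ Finset.range (L + 1),
      C ((L.choose k : ℝ) ^ 2) * ((X - 1) ^ k * (X + 1) ^ (L - k)) := by
  have h : (X ^ 2 - 1 : ℝ[X]) ^ L = (X - C 1) ^ L * (X + C 1) ^ L := by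
    rw [← mul_pow, C_1]; ring
  rw [legendre, h, iterate_derivative_mul, Finset.mul_sum, Finset.mul_sum]
  refine Finset.sum_congr rfl fun k hk => ?_
  have hk' : k ≤ L := Nat.lt_succ_iff.1 (Finset.mem_range.1 hk)
  rw [iterate_derivative_X_add_pow, iterate_derivative_X_sub_pow, Nat.sub_sub_self hk',
    Nat.descFactorial_eq_factorial_mul_choose, Nat.descFactorial_eq_factorial_mul_choose,
    Nat.choose_symm hk']
  simp only [nsmul_eq_mul, ← C_eq_natCast, C_1]
  have hc : C (1 / (2 ^ L * (L.factorial : ℝ))) * (C (L.choose k : ℝ) *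
      (C (((L - k).factorial * L.choose k : ℕ) : ℝ) * C ((k.factorial * L.choose k : ℕ) : ℝ))) =
      C (1 / 2 ^ L) * C ((L.choose k : ℝ) ^ 2) := by
    simp only [← C_mul]
    congr 1
    rw [← Nat.choose_mul_factorial_mul_factorial hk']
    have := Nat.choose_pos hk'
    push_cast
    field_simp
  rw [← mul_assoc (C (1 / 2 ^ L)), ← hc]
  ring

theorem middleCoeff_legendre {l L : ℕ} (hL : L ≤ 2 * l) :
    middleCoeff l (legendre L) = ∑ k ∈ Finset.range (l + 1),
      (-1) ^ (l - k) * ((2 * l - L).choose (l - k) : ℝ) * (L.choose k : ℝ) ^ 2 := by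
  rw [legendre_eq_sum, linearMap_C_mul, map_sum, Finset.mul_sum]
  have h1 : ∀ k ∈ Finset.range (L + 1), 1 / 2 ^ L * middleCoeff l
      (C ((L.choose k : ℝ) ^ 2) * ((X - 1) ^ k * (X + 1) ^ (L - k))) =
      if k ≤ l then (-1) ^ (l - k) * ((2 * l - L).choose (l - k) : ℝ) * (L.choose k : ℝ) ^ 2
        else 0 := by
    intro k hk
    rw [linearMap_C_mul, middleCoeff_factors hL (Nat.lt_succ_iff.1 (Finset.mem_range.1 hk))]
    split_ifs
    · field_simp
    · simp
  rw [Finset.sum_congr rfl h1, ← Finset.sum_filter]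
  refine Finset.sum_subset ?_ ?_
  · intro k; simp
  · intro k hk hk'
    simp at hk hk'
    have : L < k := by omega
    simp [Nat.choose_eq_zero_of_lt this]

/-! ### Racah's sum at zero orders -/

theorem invFact_natCast (n : ℕ) : invFact n = 1 / (n.factorial : ℝ) := by simp [invFact]

theorem invFact_of_neg {n : ℤ} (h : n < 0) : invFact n = 0 := by simp [invFact, not_le.2 h]

theorem factorial_mul_invFact (n k : ℕ) :
    (n.factorial : ℝ) * (invFact k * invFact ((n : ℤ) - k)) = n.choose k := by
  rcases Nat.lt_or_ge n k with h | h
  · rw [invFact_of_neg (n := (n : ℤ) - k) (by omega), Nat.choose_eq_zero_of_lt h]; simp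
  · rw [← Nat.cast_sub h, invFact_natCast, invFact_natCast, Nat.cast_choose ℝ h]
    ring

/-- With `z = l - k`, the inverse factorials in Racah's sum combine into the binomials of
`middleCoeff_legendre`. -/
theorem clebschGordan_sq {l L : ℕ} (hL : L ≤ 2 * l) :
    clebschGordan l 0 l 0 L 0 ^ 2 = (2 * L + 1) * ((l.factorial : ℝ) ^ 4 /
      ((2 * l - L).factorial * (2 * l + L + 1).factorial) * middleCoeff l (legendre L) ^ 2) := by
  have hS : ∑ z ∈ Finset.range (l + l + 1), (-1 : ℝ) ^ z * invFact z * invFact (l + l - L - z) *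
      invFact (l - 0 - z) * invFact (l + 0 - z) * invFact (L - l + 0 + z) *
      invFact (L - l - 0 + z) = middleCoeff l (legendre L) /
        ((2 * l - L).factorial * (L.factorial : ℝ) ^ 2) := by
    rw [middleCoeff_legendre hL, Finset.sum_div, ← Finset.sum_range_reflect (n := l + 1)]
    symm
    refine Finset.sum_subset_zero_on_sdiff (by simp) ?_ ?_
    · intro z hz
      simp at hz
      -- Racah's range runs up to `2l`, but the terms with `z > l` contain `1/(l-z)! = 0`.
      rw [invFact_of_neg (n := (l : ℤ) - 0 - z) (by omega)]
      simp
    · intro z hz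
      have hz' : z ≤ l := Nat.lt_succ_iff.1 (Finset.mem_range.1 hz)
      rw [show l + 1 - 1 - z = l - z by omega, Nat.sub_sub_self hz', ← factorial_mul_invFact,
        ← factorial_mul_invFact L]
      push_cast [hL, hz']
      rw [show (l : ℤ) - 0 - z = l - z by ring, show (l : ℤ) + 0 - z = l - z by ring,
        show (L : ℤ) - l + 0 + z = L - (l - z) by ring,
        show (L : ℤ) - l - 0 + z = L - (l - z) by ring,
        show (l : ℤ) + l - L - z = 2 * l - L - z by ring]
      field_simp
  have hcond : |(0 : ℤ)| ≤ l ∧ |(0 : ℤ)| ≤ l ∧ |(0 : ℤ)| ≤ L ∧ (0 : ℤ) + 0 = 0 ∧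
      l ≤ l + L ∧ l ≤ l + L ∧ L ≤ l + l := by
    refine ⟨by simp, by simp, by simp, by simp, by simp, by simp, by omega⟩
  rw [clebschGordan, if_pos hcond, hS, mul_pow, mul_pow, Real.sq_sqrt (by positivity),
    Real.sq_sqrt (by positivity)]
  simp only [add_zero, sub_zero, Int.toNat_natCast, Nat.add_sub_cancel_left]
  push_cast
  rw [show l + l = 2 * l by ring]
  field_simp

theorem clebschGordan_eq_zero {l L : ℕ} (hL : 2 * l < L) : clebschGordan l 0 l 0 L 0 = 0 := by
  rw [clebschGordan, if_neg]
  omega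

/-- Two-step induction: both sides agree at `L = 0`, vanish at `L = 1`, and change by the same
factor from `n` to `n + 2`. The factorials supply what turns the squared ratio of `middleCoeff` into
the ratio of the integrals. -/
theorem clebschGordan_sq_eq_polyInt {l : ℕ} (hl : 1 ≤ l) (L : ℕ) (hL : L ≤ 2 * l) :
    clebschGordan l 0 l 0 L 0 ^ 2 =
      (2 * (L : ℝ) + 1) / 2 * polyInt (legendre l ^ 2 * legendre L) := by
  rw [clebschGordan_sq hL, div_mul_eq_mul_div (2 * (L : ℝ) + 1), mul_div_assoc]
  congr 1
  induction L using Nat.twoStepInduction with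
  | zero =>
    have hc : (cayley (2 * l) 1) = (1 - X) ^ (2 * l) := by
      rw [cayley, Finset.sum_eq_single 0]
      · simp
      · intro b _ hb
        simp [coeff_one, hb]
      · simp
    have h := Nat.choose_mul_factorial_mul_factorial (show l ≤ 2 * l by omega)
    rw [show 2 * l - l = l by omega] at h
    have h' : ((2 * l).factorial : ℝ) = (2 * l).choose l * l.factorial * l.factorial := by
      exact_mod_cast h.symm
    rw [legendre_zero, mul_one, sq (legendre l), polyInt_legendre_sq,
      middleCoeff_eq_coeff (by simp), hc, coeff_one_sub_X_pow, mul_pow, ← pow_mul, mul_comm l 2,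
      pow_mul, neg_one_sq, one_pow, one_mul, add_zero, Nat.sub_zero, Nat.factorial_succ]
    push_cast
    have := Nat.choose_pos (show l ≤ 2 * l by omega)
    rw [h']
    field_simp
  | one =>
    rw [middleCoeff_legendre_one hl, polyInt_sq_mul_legendre_one hl]; simp
  | more n ih _ =>
    have h1 := ih (by omega)
    have h2 := polyInt_sq_mul_legendre_add_two l n
    have h3 := congrArg (fun x => x ^ 2) (middleCoeff_legendre_add_two hL)
    -- With `d = 2l - n - 2 ≥ 0` as parameter, every factor of the recursions is visibly positive
    -- and can be cancelled.
    obtain ⟨d, hd⟩ := Nat.exists_eq_add_of_le hL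
    have hd' : (l : ℝ) = (n + 2 + d) / 2 := by
      have : (2 : ℝ) * l = n + 2 + d := by exact_mod_cast hd
      linarith
    rw [show 2 * l - n = d + 1 + 1 by omega, Nat.factorial_succ, Nat.factorial_succ] at h1
    rw [show 2 * l - (n + 2) = d by omega, show 2 * l + (n + 2) + 1 = 2 * l + n + 1 + 1 + 1 by ring,
      Nat.factorial_succ (2 * l + n + 1 + 1), Nat.factorial_succ (2 * l + n + 1)]
    generalize polyInt (legendre l ^ 2 * legendre (n + 2)) = I₂ at *
    generalize polyInt (legendre l ^ 2 * legendre n) = I₀ at *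
    generalize middleCoeff l (legendre (n + 2)) = T₂ at *
    generalize middleCoeff l (legendre n) = T₀ at *
    have hA : (d.factorial : ℝ) ≠ 0 := by positivity
    have hB : ((2 * l + n + 1).factorial : ℝ) ≠ 0 := by positivity
    push_cast at h1 h2 h3 ⊢
    generalize (d.factorial : ℝ) = A at *
    generalize ((2 * l + n + 1).factorial : ℝ) = B at *
    generalize (l.factorial : ℝ) ^ 4 = K at *
    rw [hd'] at *
    have p1 : (n : ℝ) + 2 ≠ 0 := by positivity
    have p2 : (d : ℝ) + 1 ≠ 0 := by positivity
    have p3 : (2 * n + 4 + d : ℝ) ≠ 0 := by positivity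
    have p4 : (2 * n + 5 + d : ℝ) ≠ 0 := by positivity
    have p5 : (d : ℝ) + 2 ≠ 0 := by positivity
    obtain rfl : I₀ = 2 * (K / ((d + 1 + 1) * ((d + 1) * A) * B) * T₀ ^ 2) := by linarith
    have p6 : ((n : ℝ) + 2) ^ 2 * ((d + 1) * (2 * n + 5 + d)) ≠ 0 := by positivity
    apply mul_left_cancel₀ p6
    have e2 : ((n : ℝ) + 2) ^ 2 * ((d + 1) * (2 * n + 5 + d)) * (I₂ / 2) =
      ((n : ℝ) + 1) ^ 2 * ((d + 2) * (2 * n + 4 + d)) *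
        (K / ((d + 1 + 1) * ((d + 1) * A) * B) * T₀ ^ 2) := by
      linear_combination (1 / 2) * h2
    have e3 : ((n : ℝ) + 2) ^ 2 * (d + 1) ^ 2 * T₂ ^ 2 =
        ((n : ℝ) + 1) ^ 2 * (2 * n + 4 + d) ^ 2 * T₀ ^ 2 := by
      linear_combination h3
    rw [e2, show 2 * (((n : ℝ) + 2 + d) / 2) + n + 1 + 1 + 1 = 2 * n + 5 + d by ring,
      show 2 * (((n : ℝ) + 2 + d) / 2) + n + 1 + 1 = 2 * n + 4 + d by ring,
      show (d : ℝ) + 1 + 1 = d + 2 by ring]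
    field_simp
    linear_combination K * e3

end CapHarmonics

namespace CapHarmonics
open scoped ENNReal Pointwise

/-! ### Surface measure in cylindrical coordinates -/

/-- Cylindrical coordinates `(cos θ, φ)` on the sphere. -/
noncomputable def cylindrical (x : S2) : ℝ × ℝ := (x.1 2, longitude x)

theorem measurable_arg_pair : Measurable fun p : ℝ × ℝ => Complex.arg ⟨p.1, p.2⟩ :=
  Complex.measurable_arg.comp Complex.measurableEquivRealProd.symm.measurable

theorem measurable_cylindrical : Measurable cylindrical := by
  refine Measurable.prodMk (by fun_prop) ?_
  exact measurable_arg_pair.comp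
    (g := fun p : ℝ × ℝ => Complex.arg ⟨p.1, p.2⟩) (f := fun x : S2 => (x.1 0, x.1 1))
    (by fun_prop)

/-- Splitting off the third coordinate of Euclidean three-space. -/
noncomputable def splitThird (y : EuclideanSpace ℝ (Fin 3)) : ℝ × ℝ × ℝ := (y 2, y 0, y 1)

theorem measurePreserving_splitThird : MeasurePreserving splitThird := by
  have h1 := PiLp.volume_preserving_ofLp (Fin 3)
  have h2 := volume_preserving_piFinSuccAbove (fun _ : Fin 3 => ℝ) 2
  have h3 := (MeasurePreserving.id (volume : Measure ℝ)).prod (volume_preserving_finTwoArrow ℝ)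
  exact h3.comp (h2.comp h1)

/-- The part of the unit ball lying over a set of cylindrical coordinates. -/
def coneSet (A : Set (ℝ × ℝ)) : Set (ℝ × ℝ × ℝ) :=
  {q | 0 < q.1 ^ 2 + (q.2.1 ^ 2 + q.2.2 ^ 2) ∧ q.1 ^ 2 + (q.2.1 ^ 2 + q.2.2 ^ 2) < 1 ∧
    (q.1 / Real.sqrt (q.1 ^ 2 + (q.2.1 ^ 2 + q.2.2 ^ 2)), Complex.arg ⟨q.2.1, q.2.2⟩) ∈ A}

theorem measurableSet_coneSet {A : Set (ℝ × ℝ)} (hA : MeasurableSet A) :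
    MeasurableSet (coneSet A) := by
  have h1 : MeasurableSet {q : ℝ × ℝ × ℝ | 0 < q.1 ^ 2 + (q.2.1 ^ 2 + q.2.2 ^ 2)} :=
    measurableSet_lt (by fun_prop) (by fun_prop)
  have h2 : MeasurableSet {q : ℝ × ℝ × ℝ | q.1 ^ 2 + (q.2.1 ^ 2 + q.2.2 ^ 2) < 1} :=
    measurableSet_lt (by fun_prop) (by fun_prop)
  have h3 : Measurable fun q : ℝ × ℝ × ℝ => (q.1 / Real.sqrt (q.1 ^ 2 + (q.2.1 ^ 2 + q.2.2 ^ 2)),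
      Complex.arg ⟨q.2.1, q.2.2⟩) :=
    Measurable.prodMk (by fun_prop) (measurable_arg_pair.comp measurable_snd)
  exact h1.inter (h2.inter (h3 hA))

theorem arg_smul_pair {r : ℝ} (hr : 0 < r) (a b : ℝ) :
    Complex.arg ⟨r * a, r * b⟩ = Complex.arg ⟨a, b⟩ := by
  rw [← Complex.arg_real_mul ⟨a, b⟩ hr]
  congr 1
  apply Complex.ext <;> simp

/-- `toSphere` measures a subset of the sphere by the volume of the cone over it; this describes
that cone in coordinates `(z, x, y)`. -/
theorem Ioo_smul_cylindrical_preimage (A : Set (ℝ × ℝ)) :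
    Set.Ioo (0 : ℝ) 1 • ((↑) '' (cylindrical ⁻¹' A) : Set (EuclideanSpace ℝ (Fin 3))) =
      splitThird ⁻¹' coneSet A := by
  have hnorm : ∀ y : EuclideanSpace ℝ (Fin 3), y 2 ^ 2 + (y 0 ^ 2 + y 1 ^ 2) = ‖y‖ ^ 2 := by
    intro y
    rw [EuclideanSpace.real_norm_sq_eq, Fin.sum_univ_three]; ring
  ext y
  simp only [Set.mem_smul, Set.mem_image, Set.mem_preimage, coneSet, Set.mem_ofPred_eq, splitThird,
    hnorm, Real.sqrt_sq (norm_nonneg y)]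
  constructor
  · rintro ⟨r, ⟨hr0, hr1⟩, _, ⟨x, hx, rfl⟩, rfl⟩
    have hx1 : ‖(x : EuclideanSpace ℝ (Fin 3))‖ = 1 := by simp
    have hn : ‖r • (x : EuclideanSpace ℝ (Fin 3))‖ = r := by
      rw [norm_smul, hx1, mul_one, Real.norm_of_nonneg hr0.le]
    rw [hn]
    refine ⟨by positivity, by nlinarith, ?_⟩
    simp only [PiLp.smul_apply, smul_eq_mul]
    rw [mul_div_cancel_left₀ _ hr0.ne', arg_smul_pair hr0]
    exact hx
  · rintro ⟨h0, h1, hA⟩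
    have hpos : 0 < ‖y‖ := by
      rcases (norm_nonneg y).lt_or_eq with h | h
      · exact h
      · rw [← h] at h0; simp at h0
    refine ⟨‖y‖, ⟨hpos, by nlinarith⟩, ‖y‖⁻¹ • y, ⟨⟨‖y‖⁻¹ • y, ?_⟩, ?_, rfl⟩, ?_⟩
    · simp [norm_smul, hpos.ne']
    · simp only [cylindrical, longitude, PiLp.smul_apply, smul_eq_mul]
      rw [arg_smul_pair (inv_pos.2 hpos), inv_mul_eq_div]
      exact hA
    · rw [smul_smul, mul_inv_cancel₀ hpos.ne', one_smul]

theorem lintegral_sin_mul_comp_cos (k : ℝ → ℝ≥0∞) :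
    ∫⁻ α in Set.Ioo 0 Real.pi, ENNReal.ofReal (Real.sin α) * k (Real.cos α) =
      ∫⁻ μ in Set.Ioo (-1 : ℝ) 1, k μ := by
  have himg : Real.cos '' Set.Ioo 0 Real.pi = Set.Ioo (-1) 1 := by
    ext μ
    constructor
    · rintro ⟨α, ⟨h0, h1⟩, rfl⟩
      constructor
      · rw [← Real.cos_pi]
        exact Real.cos_lt_cos_of_nonneg_of_le_pi h0.le le_rfl h1
      · rw [← Real.cos_zero]
        exact Real.cos_lt_cos_of_nonneg_of_le_pi le_rfl h1.le h0
    · rintro ⟨h0, h1⟩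
      exact ⟨Real.arccos μ, ⟨Real.arccos_pos.2 h1, by
        rw [← Real.arccos_neg_one]
        exact Real.strictAntiOn_arccos ⟨le_rfl, by norm_num⟩ ⟨h0.le, h1.le⟩ h0⟩,
        Real.cos_arccos h0.le h1.le⟩
  rw [← himg, lintegral_image_eq_lintegral_abs_deriv_mul measurableSet_Ioo
    (fun α _ => (Real.hasDerivAt_cos α).hasDerivWithinAt)
    (Real.injOn_cos.mono Set.Ioo_subset_Icc_self)]
  refine setLIntegral_congr_fun measurableSet_Ioo fun α hα => ?_
  rw [abs_neg, abs_of_pos (Real.sin_pos_of_pos_of_lt_pi hα.1 hα.2)]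

theorem lintegral_sq_Ioo : ∫⁻ r in Set.Ioi (0 : ℝ), ENNReal.ofReal (r ^ 2) *
    (if r < 1 then 1 else 0) = ENNReal.ofReal (1 / 3) := by
  have h1 : ∫⁻ r in Set.Ioi (0 : ℝ), ENNReal.ofReal (r ^ 2) * (if r < 1 then 1 else 0) =
      ∫⁻ r in Set.Ioc (0 : ℝ) 1, ENNReal.ofReal (r ^ 2) := by
    rw [← restrict_Ioo_eq_restrict_Ioc, ← Set.Ioi_inter_Iio, Set.inter_comm,
      ← Measure.restrict_restrict measurableSet_Iio, ← lintegral_indicator measurableSet_Iio]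
    refine lintegral_congr fun r => ?_
    by_cases h : r < 1 <;> simp [h]
  rw [h1, ← ofReal_integral_eq_lintegral_ofReal]
  · rw [← intervalIntegral.integral_of_le zero_le_one, integral_pow]; norm_num
  · exact ((continuous_id.pow 2).integrableOn_Icc).mono_set Set.Ioc_subset_Icc_self
  · exact Filter.Eventually.of_forall fun r => sq_nonneg r

/-- Polar coordinates `z = r cos α`, `ρ = r sin α` in the half-plane `ρ > 0` turn `ρ dρ dz` into `r²
sin α dr dα`. The radial part contributes `1/3`, and `μ = cos α` absorbs `sin α`. -/
theorem lintegral_half_plane (k : ℝ → ℝ≥0∞) (hk : Measurable k) :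
    ∫⁻ z : ℝ, ∫⁻ ρ in Set.Ioi (0 : ℝ), ENNReal.ofReal ρ *
      (if z ^ 2 + ρ ^ 2 < 1 then k (z / Real.sqrt (z ^ 2 + ρ ^ 2)) else 0) =
    ENNReal.ofReal (1 / 3) * ∫⁻ μ in Set.Ioo (-1 : ℝ) 1, k μ := by
  set F : ℝ × ℝ → ℝ≥0∞ := fun p => if 0 < p.2 then ENNReal.ofReal p.2 *
      (if p.1 ^ 2 + p.2 ^ 2 < 1 then k (p.1 / Real.sqrt (p.1 ^ 2 + p.2 ^ 2)) else 0) else 0 with hF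
  have hFm : Measurable F := by
    refine Measurable.ite (measurableSet_lt (by fun_prop) (by fun_prop)) ?_ measurable_const
    refine Measurable.mul (by fun_prop) ?_
    exact Measurable.ite (measurableSet_lt (by fun_prop) (by fun_prop))
      (hk.comp (by fun_prop)) measurable_const
  have h1 : ∫⁻ z : ℝ, ∫⁻ ρ in Set.Ioi (0 : ℝ), ENNReal.ofReal ρ *
      (if z ^ 2 + ρ ^ 2 < 1 then k (z / Real.sqrt (z ^ 2 + ρ ^ 2)) else 0) = ∫⁻ p, F p := by
    rw [Measure.volume_eq_prod, lintegral_prod _ hFm.aemeasurable]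
    refine lintegral_congr fun z => ?_
    rw [← lintegral_indicator measurableSet_Ioi]
    refine lintegral_congr fun ρ => ?_
    by_cases h : 0 < ρ <;> simp [h, hF]
  rw [h1, ← lintegral_comp_polarCoord_symm]
  -- `polarCoord` parametrises the plane by `α ∈ (-π, π)`; the condition `ρ > 0` built into `F` cuts
  -- this to `(0, π)`.
  have h2 : ∫⁻ p in polarCoord.target, ENNReal.ofReal p.1 • F (polarCoord.symm p) =
      ∫⁻ p in polarCoord.target, (ENNReal.ofReal (p.1 ^ 2) * (if p.1 < 1 then 1 else 0)) *
        (Set.Ioo 0 Real.pi).indicator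
          (fun α => ENNReal.ofReal (Real.sin α) * k (Real.cos α)) p.2 := by
    refine setLIntegral_congr_fun polarCoord.open_target.measurableSet fun p hp => ?_
    obtain ⟨r, α⟩ := p
    obtain ⟨hr, hα⟩ := hp
    simp only [Set.mem_Ioi] at hr
    have hsq : (r * Real.cos α) ^ 2 + (r * Real.sin α) ^ 2 = r ^ 2 := by
      linear_combination r ^ 2 * Real.cos_sq_add_sin_sq α
    simp only [polarCoord_symm_apply, hF, hsq, Real.sqrt_sq hr.le, smul_eq_mul,
      mul_div_cancel_left₀ _ hr.ne', sq_lt_one_iff₀ hr.le]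
    by_cases h0 : 0 < α
    · have hs := Real.sin_pos_of_pos_of_lt_pi h0 hα.2
      rw [if_pos (mul_pos hr hs), Set.indicator_of_mem (show α ∈ Set.Ioo 0 Real.pi from ⟨h0, hα.2⟩),
        ENNReal.ofReal_mul hr.le, sq, ENNReal.ofReal_mul hr.le]
      split_ifs <;> ring
    · have hs : Real.sin α ≤ 0 := Real.sin_nonpos_of_nonpos_of_neg_pi_le (not_lt.1 h0) hα.1.le
      rw [if_neg (not_lt.2 (mul_nonpos_of_nonneg_of_nonpos hr.le hs)),
        Set.indicator_of_notMem (fun h => h0 h.1)]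
      simp
  have hm : Measurable fun α => ENNReal.ofReal (Real.sin α) * k (Real.cos α) := by fun_prop
  rw [h2, polarCoord_target, Measure.volume_eq_prod, ← Measure.prod_restrict,
    lintegral_prod_mul (f := fun r : ℝ => ENNReal.ofReal (r ^ 2) * (if r < 1 then 1 else 0))
      (Measurable.aemeasurable (by
        refine Measurable.mul (by fun_prop) ?_
        exact Measurable.ite measurableSet_Iio measurable_const measurable_const))
      (hm.indicator measurableSet_Ioo).aemeasurable,
    lintegral_sq_Ioo, lintegral_indicator measurableSet_Ioo,
    Measure.restrict_restrict measurableSet_Ioo,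
    Set.inter_eq_left.2 (Set.Ioo_subset_Ioo_left (by linarith [Real.pi_pos])),
    lintegral_sin_mul_comp_cos]

/-- Polar coordinates in the `(x, y)`-plane produce the longitude; after exchanging the integrals,
`lintegral_half_plane` treats each half-plane of fixed longitude. -/
theorem volume_coneSet {A : Set (ℝ × ℝ)} (hA : MeasurableSet A) :
    3 * volume (coneSet A) =
      ((volume.restrict (Set.Ioo (-1 : ℝ) 1)).prod
        (volume.restrict (Set.Ioo (-Real.pi) Real.pi))) A := by
  set k : ℝ → ℝ → ℝ≥0∞ := fun φ μ => A.indicator 1 (μ, φ) with hk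
  have hkm : Measurable fun p : ℝ × ℝ => A.indicator (1 : ℝ × ℝ → ℝ≥0∞) p :=
    measurable_one.indicator hA
  have hGm : Measurable fun q : ℝ × ℝ × ℝ => ENNReal.ofReal q.2.1 *
      (if q.1 ^ 2 + q.2.1 ^ 2 < 1 then
        k q.2.2 (q.1 / Real.sqrt (q.1 ^ 2 + q.2.1 ^ 2)) else 0) := by
    refine Measurable.mul (by fun_prop) ?_
    exact Measurable.ite (measurableSet_lt (by fun_prop) (by fun_prop))
      (hkm.comp (g := fun p : ℝ × ℝ => A.indicator (1 : ℝ × ℝ → ℝ≥0∞) p)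
        (f := fun q : ℝ × ℝ × ℝ => (q.1 / Real.sqrt (q.1 ^ 2 + q.2.1 ^ 2), q.2.2)) (by fun_prop))
      measurable_const
  have h1 : volume (coneSet A) = ∫⁻ z : ℝ, ∫⁻ p in polarCoord.target, ENNReal.ofReal p.1 *
      (if z ^ 2 + p.1 ^ 2 < 1 then k p.2 (z / Real.sqrt (z ^ 2 + p.1 ^ 2)) else 0) := by
    rw [← lintegral_indicator_one (measurableSet_coneSet hA), Measure.volume_eq_prod,
      lintegral_prod _ (measurable_one.indicator (measurableSet_coneSet hA)).aemeasurable]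
    refine lintegral_congr fun z => ?_
    rw [← lintegral_comp_polarCoord_symm]
    refine setLIntegral_congr_fun polarCoord.open_target.measurableSet fun p hp => ?_
    obtain ⟨r, φ⟩ := p
    obtain ⟨hr, hφ⟩ := hp
    simp only [Set.mem_Ioi] at hr
    have hsq : (r * Real.cos φ) ^ 2 + (r * Real.sin φ) ^ 2 = r ^ 2 := by
      linear_combination r ^ 2 * Real.cos_sq_add_sin_sq φ
    have harg : Complex.arg ⟨r * Real.cos φ, r * Real.sin φ⟩ = φ := by
      rw [arg_smul_pair hr]
      have := Complex.arg_cos_add_sin_mul_I (Set.Ioo_subset_Ioc_self hφ)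
      convert this using 2
      apply Complex.ext
      · simpa using (Complex.cos_ofReal_re φ).symm
      · simpa using (Complex.sin_ofReal_re φ).symm
    have hpos : 0 < z ^ 2 + r ^ 2 := by positivity
    simp only [polarCoord_symm_apply, smul_eq_mul]
    congr 1
    by_cases h : z ^ 2 + r ^ 2 < 1
    · rw [if_pos h, hk]
      beta_reduce
      by_cases h2 : (z / Real.sqrt (z ^ 2 + r ^ 2), φ) ∈ A
      · rw [Set.indicator_of_mem h2, Set.indicator_of_mem]
        · simp
        · simp only [coneSet, Set.mem_ofPred_eq, hsq, harg]
          exact ⟨hpos, h, h2⟩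
      · rw [Set.indicator_of_notMem h2, Set.indicator_of_notMem]
        simp only [coneSet, Set.mem_ofPred_eq, hsq, harg]
        exact fun h3 => h2 h3.2.2
    · rw [if_neg h, Set.indicator_of_notMem]
      simp only [coneSet, Set.mem_ofPred_eq, hsq]
      exact fun h3 => h h3.2.1
  have h2 : volume (coneSet A) = ∫⁻ φ in Set.Ioo (-Real.pi) Real.pi, ENNReal.ofReal (1 / 3) *
      ∫⁻ μ in Set.Ioo (-1 : ℝ) 1, k φ μ := by
    rw [h1, polarCoord_target, Measure.volume_eq_prod, ← Measure.prod_restrict]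
    have e : ∀ z : ℝ, ∫⁻ p, ENNReal.ofReal p.1 *
        (if z ^ 2 + p.1 ^ 2 < 1 then k p.2 (z / Real.sqrt (z ^ 2 + p.1 ^ 2)) else 0)
        ∂((volume.restrict (Set.Ioi (0 : ℝ))).prod
          (volume.restrict (Set.Ioo (-Real.pi) Real.pi))) =
        ∫⁻ φ in Set.Ioo (-Real.pi) Real.pi, ∫⁻ ρ in Set.Ioi (0 : ℝ), ENNReal.ofReal ρ *
          (if z ^ 2 + ρ ^ 2 < 1 then k φ (z / Real.sqrt (z ^ 2 + ρ ^ 2)) else 0) := by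
      intro z
      rw [lintegral_prod_symm]
      exact (hGm.comp (measurable_const.prodMk measurable_id)).aemeasurable
    simp only [e]
    rw [lintegral_lintegral_swap]
    · refine lintegral_congr fun φ => ?_
      exact lintegral_half_plane _ (hkm.comp (measurable_id.prodMk measurable_const))
    · refine Measurable.aemeasurable ?_
      refine Measurable.lintegral_prod_right' (f := fun q : (ℝ × ℝ) × ℝ => ENNReal.ofReal q.2 *
          (if q.1.1 ^ 2 + q.2 ^ 2 < 1 then
            k q.1.2 (q.1.1 / Real.sqrt (q.1.1 ^ 2 + q.2 ^ 2)) else 0)) ?_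
      exact hGm.comp (g := fun q : ℝ × ℝ × ℝ => ENNReal.ofReal q.2.1 *
          (if q.1 ^ 2 + q.2.1 ^ 2 < 1 then
            k q.2.2 (q.1 / Real.sqrt (q.1 ^ 2 + q.2.1 ^ 2)) else 0))
        (f := fun q : (ℝ × ℝ) × ℝ => (q.1.1, q.2, q.1.2)) (by fun_prop)
  rw [h2, lintegral_const_mul' _ _ ENNReal.ofReal_ne_top, ← mul_assoc]
  have h3 : (3 : ℝ≥0∞) * ENNReal.ofReal (1 / 3) = 1 := by
    rw [← ENNReal.ofReal_ofNat, ← ENNReal.ofReal_mul (by norm_num)]; norm_num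
  rw [h3, one_mul, Measure.prod_apply_symm hA]
  refine lintegral_congr fun φ => ?_
  rw [← lintegral_indicator_one (measurable_prodMk_right hA)]
  rfl

/-- Archimedes' theorem. The dimension factor `3` in `toSphere` cancels the radial `1/3`. -/
theorem map_cylindrical_surface : surface.map cylindrical =
    (volume.restrict (Set.Ioo (-1 : ℝ) 1)).prod
        (volume.restrict (Set.Ioo (-Real.pi) Real.pi)) := by
  ext A hA
  rw [Measure.map_apply measurable_cylindrical hA, surface,
    Measure.toSphere_apply' _ (measurable_cylindrical hA), Ioo_smul_cylindrical_preimage,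
    measurePreserving_splitThird.measure_preimage (measurableSet_coneSet hA).nullMeasurableSet,
    finrank_euclideanSpace, Fintype.card_fin, ← volume_coneSet hA, Nat.cast_ofNat]

end CapHarmonics

namespace CapHarmonics
open Polynomial

/-! ### The radial profile -/

theorem bernstein_eval (n i : ℕ) (t : ℝ) :
    (bernsteinPolynomial ℝ n i).eval t = n.choose i * t ^ i * (1 - t) ^ (n - i) := by
  simp [bernsteinPolynomial]

theorem bernstein_eval_nonneg (n i : ℕ) {t : ℝ} (h0 : 0 ≤ t) (h1 : t ≤ 1) :
    0 ≤ (bernsteinPolynomial ℝ n i).eval t := by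
  have : 0 ≤ 1 - t := by linarith
  rw [bernstein_eval]; positivity

theorem blend_eval (k : ℕ) (t : ℝ) :
    (blend k).eval t = ∑ i ∈ Finset.range (k + 1), (bernsteinPolynomial ℝ (2 * k + 1) i).eval t := by
  rw [blend, eval_finsetSum]

/-- The Bernstein partition of unity of degree `2k+1`, cut into its lower half and its upper half,
the latter indexed by reflection. -/
theorem blend_add_reflect (k : ℕ) (t : ℝ) :
    (blend k).eval t + ∑ i ∈ Finset.range (k + 1),
      (bernsteinPolynomial ℝ (2 * k + 1) (2 * k + 1 - i)).eval t = 1 := by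
  have h := congrArg (eval t) (bernsteinPolynomial.sum ℝ (2 * k + 1))
  rw [eval_finsetSum, eval_one, show 2 * k + 1 + 1 = (k + 1) + (k + 1) by ring,
    Finset.sum_range_add] at h
  rw [← h, blend_eval, ← Finset.sum_range_reflect (n := k + 1)
    (f := fun i => (bernsteinPolynomial ℝ (2 * k + 1) (2 * k + 1 - i)).eval t)]
  congr 1
  refine Finset.sum_congr rfl fun i hi => ?_
  rw [Finset.mem_range] at hi
  congr 2; omega

theorem blend_eval_nonneg (k : ℕ) {t : ℝ} (h0 : 0 ≤ t) (h1 : t ≤ 1) : 0 ≤ (blend k).eval t := by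
  rw [blend_eval]
  exact Finset.sum_nonneg fun i _ => bernstein_eval_nonneg _ _ h0 h1

theorem blend_eval_le_one (k : ℕ) {t : ℝ} (h0 : 0 ≤ t) (h1 : t ≤ 1) : (blend k).eval t ≤ 1 := by
  have h := blend_add_reflect k t
  have : 0 ≤ ∑ i ∈ Finset.range (k + 1),
      (bernsteinPolynomial ℝ (2 * k + 1) (2 * k + 1 - i)).eval t :=
    Finset.sum_nonneg fun i _ => bernstein_eval_nonneg _ _ h0 h1
  linarith

/-- For `t ≤ 1 - t` each Bernstein term of index `i ≤ k` dominates its mirror image, so the lower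
half carries at least half of the total mass `1`. -/
theorem half_le_blend_eval (k : ℕ) {t : ℝ} (h0 : 0 ≤ t) (h1 : t ≤ 1 / 2) :
    1 / 2 ≤ (blend k).eval t := by
  have h := blend_add_reflect k t
  have : ∑ i ∈ Finset.range (k + 1),
      (bernsteinPolynomial ℝ (2 * k + 1) (2 * k + 1 - i)).eval t ≤ (blend k).eval t := by
    rw [blend_eval]
    refine Finset.sum_le_sum fun i hi => ?_
    rw [Finset.mem_range] at hi
    rw [bernstein_eval, bernstein_eval, Nat.choose_symm (by omega), Nat.sub_sub_self (by omega),
      show 2 * k + 1 - i = i + (2 * k + 1 - 2 * i) by omega, pow_add, pow_add]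
    have h2 : t ^ (2 * k + 1 - 2 * i) ≤ (1 - t) ^ (2 * k + 1 - 2 * i) :=
      pow_le_pow_left₀ h0 (by linarith) _
    have h3 : 0 ≤ 1 - t := by linarith
    calc _ = ((2 * k + 1).choose i : ℝ) * t ^ i * (1 - t) ^ i * t ^ (2 * k + 1 - 2 * i) := by ring
      _ ≤ ((2 * k + 1).choose i : ℝ) * t ^ i * (1 - t) ^ i * (1 - t) ^ (2 * k + 1 - 2 * i) := by
        gcongr
      _ = _ := by ring
  linarith

theorem profile_mem_Icc (k : ℕ) (r : ℝ) {ε : ℝ} (hε : 0 < ε) (θ : ℝ) :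
    profile k r ε θ ∈ Set.Icc (0 : ℝ) 1 := by
  unfold profile
  split_ifs with h1 h2
  · simp
  · have h3 : 0 ≤ (θ - r + ε) / ε := div_nonneg (by linarith) hε.le
    have h4 : (θ - r + ε) / ε ≤ 1 := (div_le_one hε).2 (by linarith)
    exact ⟨blend_eval_nonneg k h3 h4, blend_eval_le_one k h3 h4⟩
  · simp

theorem half_le_profile (k : ℕ) {r ε θ : ℝ} (hε : 0 < ε) (hεr : ε < r) (hθ : θ ≤ r / 2) :
    1 / 2 ≤ profile k r ε θ := by
  unfold profile
  split_ifs with h1 h2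
  · norm_num
  · refine half_le_blend_eval k (div_nonneg (by linarith) hε.le) ?_
    -- From `θ ≤ r/2` and `ε < r`: `θ - r + ε ≤ ε - r/2 ≤ ε/2`.
    rw [div_le_iff₀ hε]; linarith
  · linarith

theorem measurable_profile (k : ℕ) (r ε : ℝ) : Measurable (profile k r ε) := by
  refine Measurable.ite measurableSet_Iio measurable_const ?_
  refine Measurable.ite measurableSet_Iic ?_ measurable_const
  exact (blend k).continuous.measurable.comp (by fun_prop)

/-- The profile as a function of `μ = cos θ`. -/
noncomputable def capWeight (k : ℕ) (r ε μ : ℝ) : ℝ := profile k r ε (Real.arccos μ)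

theorem measurable_capWeight (k : ℕ) (r ε : ℝ) : Measurable (capWeight k r ε) :=
  (measurable_profile k r ε).comp Real.measurable_arccos

theorem abs_capWeight_le (k : ℕ) (r : ℝ) {ε : ℝ} (hε : 0 < ε) (μ : ℝ) :
    |capWeight k r ε μ| ≤ 1 := by
  have h := profile_mem_Icc k r hε (Real.arccos μ)
  rw [capWeight, abs_of_nonneg h.1]; exact h.2

/-! ### Bounded weights as functionals on polynomials -/

theorem integrableOn_mul_of_bounded {f g : ℝ → ℝ} (hf : Measurable f) (hb : ∀ x, |f x| ≤ 1)
    (hg : Continuous g) : IntegrableOn (fun μ => f μ * g μ) (Set.Icc (-1) 1) :=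
  hg.integrableOn_Icc.bdd_mul (c := 1) hf.aestronglyMeasurable
    (Filter.Eventually.of_forall hb)

theorem intervalIntegrable_mul_of_bounded {f g : ℝ → ℝ} (hf : Measurable f)
    (hb : ∀ x, |f x| ≤ 1) (hg : Continuous g) :
    IntervalIntegrable (fun μ => f μ * g μ) volume (-1) 1 :=
  (intervalIntegrable_iff_integrableOn_Icc_of_le (by norm_num)).2
    (integrableOn_mul_of_bounded hf hb hg)

/-- The functional `p ↦ ∫_{-1}^1 f p` for a bounded weight `f`. -/
noncomputable def weightedInt (f : ℝ → ℝ) (hf : Measurable f) (hb : ∀ x, |f x| ≤ 1) :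
    ℝ[X] →ₗ[ℝ] ℝ where
  toFun p := ∫ μ in (-1 : ℝ)..1, f μ * p.eval μ
  map_add' p q := by
    simp only [eval_add, mul_add]
    exact intervalIntegral.integral_add (intervalIntegrable_mul_of_bounded hf hb p.continuous)
      (intervalIntegrable_mul_of_bounded hf hb q.continuous)
  map_smul' a p := by
    simp only [eval_smul, smul_eq_mul, mul_left_comm _ a, intervalIntegral.integral_const_mul,
      RingHom.id_apply]

theorem weightedInt_apply (f : ℝ → ℝ) (hf : Measurable f) (hb : ∀ x, |f x| ≤ 1) (p : ℝ[X]) :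
    weightedInt f hf hb p = ∫ μ in (-1 : ℝ)..1, f μ * p.eval μ := rfl

theorem assocSq_eval_nonneg (l m : ℕ) {μ : ℝ} (h : μ ∈ Set.Icc (-1 : ℝ) 1) :
    0 ≤ (assocSq l m).eval μ := by
  have : 0 ≤ 1 - μ ^ 2 := by nlinarith [h.1, h.2]
  simp only [assocSq, eval_mul, eval_C, eval_pow, eval_sub, eval_one, eval_X]
  positivity

theorem abs_weightedInt_assocSq_le (f : ℝ → ℝ) (hf : Measurable f) (hb : ∀ x, |f x| ≤ 1)
    {l m : ℕ} (hm : m ≤ l) : |weightedInt f hf hb (assocSq l m)| ≤ 2 / (2 * l + 1) := by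
  rw [weightedInt_apply, ← polyInt_assocSq l m hm, polyInt_apply]
  refine (intervalIntegral.abs_integral_le_integral_abs (by norm_num)).trans ?_
  refine intervalIntegral.integral_mono_on (by norm_num)
    (intervalIntegrable_mul_of_bounded hf hb (assocSq l m).continuous).abs
    ((assocSq l m).continuous.intervalIntegrable _ _) fun μ hμ => ?_
  have h0 := assocSq_eval_nonneg l m hμ
  rw [abs_mul, abs_of_nonneg h0]
  exact mul_le_of_le_one_left h0 (hb μ)

/-- Only the cap `μ ≥ cos(r/2)` is used, where the weight is at least `1/2`; this makes the bound
independent of `k` and `ε`. -/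
theorem integral_capWeight_ge (k : ℕ) {r ε : ℝ} (hr : r < Real.pi) (hε : 0 < ε) (hεr : ε < r) :
    (1 - Real.cos (r / 2)) / 2 ≤ ∫ μ in (-1 : ℝ)..1, capWeight k r ε μ := by
  have hi : IntervalIntegrable (capWeight k r ε) volume (-1) 1 := by
    simpa using intervalIntegrable_mul_of_bounded (measurable_capWeight k r ε)
      (abs_capWeight_le k r hε) (continuous_const (y := (1 : ℝ)))
  have hc1 : -1 ≤ Real.cos (r / 2) := Real.neg_one_le_cos _
  have hc2 : Real.cos (r / 2) ≤ 1 := Real.cos_le_one _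
  have h1 : IntervalIntegrable (capWeight k r ε) volume (-1) (Real.cos (r / 2)) :=
    hi.mono_set (by
      rw [Set.uIcc_of_le hc1, Set.uIcc_of_le (by norm_num)]
      exact Set.Icc_subset_Icc_right hc2)
  have h2 : IntervalIntegrable (capWeight k r ε) volume (Real.cos (r / 2)) 1 :=
    hi.mono_set (by
      rw [Set.uIcc_of_le hc2, Set.uIcc_of_le (by norm_num)]
      exact Set.Icc_subset_Icc_left hc1)
  rw [← intervalIntegral.integral_add_adjacent_intervals h1 h2]
  have e1 : 0 ≤ ∫ μ in (-1 : ℝ)..Real.cos (r / 2), capWeight k r ε μ :=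
    intervalIntegral.integral_nonneg hc1 fun μ _ => (profile_mem_Icc k r hε _).1
  have e2 : ∫ _ in Real.cos (r / 2)..1, (1 / 2 : ℝ) ≤
      ∫ μ in Real.cos (r / 2)..1, capWeight k r ε μ := by
    refine intervalIntegral.integral_mono_on hc2 (by simp) h2 fun μ hμ => ?_
    refine half_le_profile k hε hεr ?_
    rw [← Real.arccos_cos (x := r / 2) (by linarith) (by linarith)]
    exact Real.antitone_arccos hμ.1
  rw [intervalIntegral.integral_const, smul_eq_mul] at e2
  linarith

/-! ### The second chaos as a diagonal quadratic form -/

theorem integral_cexp_int (n : ℤ) :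
    ∫ φ in Set.Ioo (-Real.pi) Real.pi, Complex.exp (Complex.I * n * φ) =
      if n = 0 then 2 * Real.pi else 0 := by
  rw [← integral_Ioc_eq_integral_Ioo,
    ← intervalIntegral.integral_of_le (by linarith [Real.pi_pos])]
  split_ifs with h
  · subst h; simp; ring
  · have hn : (n : ℂ) ≠ 0 := by exact_mod_cast h
    rw [integral_exp_mul_complex (mul_ne_zero Complex.I_ne_zero hn)]
    have e : Complex.exp (Complex.I * n * Real.pi) =
        Complex.exp (Complex.I * n * (-Real.pi : ℝ)) := by
      rw [Complex.exp_eq_exp_iff_exists_int]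
      exact ⟨n, by push_cast; ring⟩
    rw [e, sub_self, zero_div]; simp

theorem integral_re_mul_re (c c' : ℂ) (m m' : ℕ) :
    ∫ φ in Set.Ioo (-Real.pi) Real.pi, (c * Complex.exp (Complex.I * m * φ)).re *
      (c' * Complex.exp (Complex.I * m' * φ)).re =
    if m = m' then (if m = 0 then 2 * Real.pi * (c.re * c'.re)
      else Real.pi * (c * (starRingEnd ℂ) c').re) else 0 := by
  have hpt : ∀ φ : ℝ, (c * Complex.exp (Complex.I * m * φ)).re *
      (c' * Complex.exp (Complex.I * m' * φ)).re =
      (c * c' / 2 * Complex.exp (Complex.I * ((m + m' : ℤ) : ℂ) * φ) +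
        c * (starRingEnd ℂ) c' / 2 * Complex.exp (Complex.I * ((m - m' : ℤ) : ℂ) * φ)).re := by
    intro φ
    have h1 : Complex.exp (Complex.I * ((m + m' : ℤ) : ℂ) * φ) =
        Complex.exp (Complex.I * m * φ) * Complex.exp (Complex.I * m' * φ) := by
      rw [← Complex.exp_add]; push_cast; ring_nf
    have h2 : Complex.exp (Complex.I * ((m - m' : ℤ) : ℂ) * φ) =
        Complex.exp (Complex.I * m * φ) * (starRingEnd ℂ) (Complex.exp (Complex.I * m' * φ)) := by
      rw [← Complex.exp_conj, ← Complex.exp_add]; push_cast; simp; ring_nf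
    have h3 : ∀ z w : ℂ, z.re * w.re = (z * w / 2 + z * (starRingEnd ℂ) w / 2).re := by
      intro z w; simp; ring
    rw [h1, h2, h3, map_mul]
    congr 1; ring
  have hint : ∀ (d : ℂ) (n : ℤ), IntegrableOn (fun φ : ℝ => d * Complex.exp (Complex.I * n * φ))
      (Set.Ioo (-Real.pi) Real.pi) := fun d n =>
    (Continuous.integrableOn_Icc (by fun_prop)).mono_set Set.Ioo_subset_Icc_self
  simp only [hpt]
  have hre := integral_re (𝕜 := ℂ) ((hint (c * c' / 2) (m + m')).add
    (hint (c * (starRingEnd ℂ) c' / 2) (m - m')))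
  simp only [Pi.add_apply, RCLike.re_to_complex] at hre
  rw [hre, integral_add (hint _ _) (hint _ _), integral_const_mul, integral_const_mul,
    integral_cexp_int, integral_cexp_int]
  by_cases h : m = m'
  · subst h
    by_cases h0 : m = 0
    · subst h0
      simp; ring
    · have : ((m : ℤ) + m) ≠ 0 := by omega
      rw [if_neg this, if_pos (sub_self _), if_pos rfl, if_neg h0]
      simp; ring
  · have h1 : ((m : ℤ) + m') ≠ 0 := by omega
    have h2 : ((m : ℤ) - m') ≠ 0 := by omega
    rw [if_neg h1, if_neg h2, if_neg h]; simp

/-- The latitude factor of the `m`-th real harmonic component. -/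
noncomputable def latitudeFactor (l m : ℕ) (μ : ℝ) : ℝ :=
  (if m = 0 then 1 else 2) *
    (Real.sqrt (((l - m).factorial : ℝ) / ((l + m).factorial : ℝ)) * assocLegendre l m μ)

theorem continuous_latitudeFactor (l m : ℕ) : Continuous (latitudeFactor l m) := by
  unfold latitudeFactor assocLegendre
  have := (derivative^[m] (legendre l)).continuous
  fun_prop

theorem latitudeFactor_sq (l m : ℕ) {μ : ℝ} (h : μ ∈ Set.Icc (-1 : ℝ) 1) :
    latitudeFactor l m μ * latitudeFactor l m μ =
      (if m = 0 then 1 else 4) * (assocSq l m).eval μ := by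
  have h2 : 0 ≤ 1 - μ ^ 2 := by nlinarith [h.1, h.2]
  have h3 : Real.sqrt (((l - m).factorial : ℝ) / ((l + m).factorial : ℝ)) ^ 2 =
    ((l - m).factorial : ℝ) / ((l + m).factorial : ℝ) := Real.sq_sqrt (by positivity)
  have h4 : (Real.sqrt (1 - μ ^ 2) ^ m) ^ 2 = (1 - μ ^ 2) ^ m := by
    rw [← pow_mul, mul_comm, pow_mul, Real.sq_sqrt h2]
  have h5 : ((-1 : ℝ) ^ m) ^ 2 = 1 := by rw [← pow_mul, mul_comm, pow_mul]; simp
  simp only [latitudeFactor, assocLegendre, assocSq, legendreDeriv, eval_mul, eval_C, eval_pow,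
    eval_sub, eval_one, eval_X]
  generalize Real.sqrt (((l - m).factorial : ℝ) / ((l + m).factorial : ℝ)) = s at h3 ⊢
  rw [← h3, ← h4]
  have e : (if m = 0 then (1 : ℝ) else 4) = (if m = 0 then 1 else 2) ^ 2 := by
    split_ifs <;> norm_num
  rw [e]
  linear_combination (if m = 0 then (1 : ℝ) else 2) ^ 2 *
    s ^ 2 * (Real.sqrt (1 - μ ^ 2) ^ m) ^ 2 * (eval μ (derivative^[m] (legendre l))) ^ 2 * h5

/-- A real spherical harmonic in cylindrical coordinates. -/
noncomputable def realHarmonic (l : ℕ) (c : ℕ → ℂ) (p : ℝ × ℝ) : ℝ :=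
  ∑ m ∈ Finset.range (l + 1), latitudeFactor l m p.1 * (c m * Complex.exp (Complex.I * m * p.2)).re

theorem continuous_realHarmonic (l : ℕ) (c : ℕ → ℂ) : Continuous (realHarmonic l c) := by
  unfold realHarmonic
  refine continuous_finsetSum _ fun m _ => ?_
  exact ((continuous_latitudeFactor l m).comp continuous_fst).mul
    (Complex.continuous_re.comp (by fun_prop))

theorem integral_Ioo_mul_latitudeFactor (f : ℝ → ℝ) (hf : Measurable f) (hb : ∀ x, |f x| ≤ 1)
    (l m : ℕ) : ∫ μ in Set.Ioo (-1 : ℝ) 1, f μ * (latitudeFactor l m μ * latitudeFactor l m μ) =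
      (if m = 0 then 1 else 4) * weightedInt f hf hb (assocSq l m) := by
  rw [weightedInt_apply, intervalIntegral.integral_of_le (by norm_num),
    integral_Ioc_eq_integral_Ioo, ← integral_const_mul]
  refine setIntegral_congr_fun measurableSet_Ioo fun μ hμ => ?_
  simp only [latitudeFactor_sq l m (Set.Ioo_subset_Icc_self hμ)]
  ring

/-- In cylindrical coordinates each product of two components factorises, and the longitude integral
vanishes unless the orders agree. For `m > 0` the constant is `4 · π`: the squared factor `2` of
`latitudeFactor` times the mean-square integral over longitude. -/
theorem integral_surface_sq (f : ℝ → ℝ) (hf : Measurable f) (hb : ∀ x, |f x| ≤ 1)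
    (l : ℕ) (c : ℕ → ℂ) :
    ∫ x, f (x.1 2) * (realHarmonic l c (cylindrical x) ^ 2 - 1) ∂surface =
      ∑ m ∈ Finset.range (l + 1), weightedInt f hf hb (assocSq l m) *
        (if m = 0 then 2 * Real.pi * (c 0).re ^ 2 else 4 * Real.pi * Complex.normSq (c m)) -
      2 * Real.pi * ∫ μ in (-1 : ℝ)..1, f μ := by
  set ν := (volume.restrict (Set.Ioo (-1 : ℝ) 1)).prod
        (volume.restrict (Set.Ioo (-Real.pi) Real.pi)) with hν
  have hm : AEStronglyMeasurable
      (fun p : ℝ × ℝ => f p.1 * (realHarmonic l c p ^ 2 - 1)) ν :=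
    ((hf.comp measurable_fst).mul
      (((continuous_realHarmonic l c).pow 2).sub continuous_const).measurable).aestronglyMeasurable
  have h1 : ∫ x, f (x.1 2) * (realHarmonic l c (cylindrical x) ^ 2 - 1) ∂surface =
      ∫ p, f p.1 * (realHarmonic l c p ^ 2 - 1) ∂ν := by
    rw [hν, ← map_cylindrical_surface, integral_map measurable_cylindrical.aemeasurable]
    · rfl
    · rw [map_cylindrical_surface]; exact hm
  have hfi : ∀ g : ℝ → ℝ, Continuous g →
      IntegrableOn (fun μ => f μ * g μ) (Set.Ioo (-1) 1) := fun g hg =>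
    (integrableOn_mul_of_bounded hf hb hg).mono_set Set.Ioo_subset_Icc_self
  have hti : ∀ m m' : ℕ, IntegrableOn (fun φ : ℝ => (c m * Complex.exp (Complex.I * m * φ)).re *
      (c m' * Complex.exp (Complex.I * m' * φ)).re) (Set.Ioo (-Real.pi) Real.pi) := by
    intro m m'
    refine (Continuous.integrableOn_Icc ?_).mono_set Set.Ioo_subset_Icc_self
    exact (Complex.continuous_re.comp (by fun_prop)).mul (Complex.continuous_re.comp (by fun_prop))
  have hterm : ∀ m m' : ℕ, Integrable (fun p : ℝ × ℝ =>
      (f p.1 * (latitudeFactor l m p.1 * latitudeFactor l m' p.1)) *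
      ((c m * Complex.exp (Complex.I * m * p.2)).re *
        (c m' * Complex.exp (Complex.I * m' * p.2)).re)) ν := fun m m' =>
    (hfi _ ((continuous_latitudeFactor l m).mul (continuous_latitudeFactor l m'))).mul_prod
      (hti m m')
  have hone : Integrable (fun p : ℝ × ℝ => f p.1 * 1) ν := by
    have := (hfi (fun _ => 1) continuous_const).mul_prod
      (μ := volume.restrict (Set.Ioo (-1 : ℝ) 1))
      (ν := volume.restrict (Set.Ioo (-Real.pi) Real.pi)) (g := fun _ : ℝ => (1 : ℝ))
      (integrable_const 1)
    simpa using this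
  have hexp : ∀ p : ℝ × ℝ, f p.1 * (realHarmonic l c p ^ 2 - 1) =
      ∑ m ∈ Finset.range (l + 1), ∑ m' ∈ Finset.range (l + 1),
        (f p.1 * (latitudeFactor l m p.1 * latitudeFactor l m' p.1)) *
        ((c m * Complex.exp (Complex.I * m * p.2)).re *
          (c m' * Complex.exp (Complex.I * m' * p.2)).re) - f p.1 * 1 := by
    intro p
    rw [mul_sub, sq, realHarmonic, Finset.sum_mul_sum, Finset.mul_sum]
    congr 1
    refine Finset.sum_congr rfl fun m _ => ?_
    rw [Finset.mul_sum]
    refine Finset.sum_congr rfl fun m' _ => ?_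
    ring
  rw [h1]
  simp only [hexp]
  rw [integral_sub (integrable_finsetSum _ fun m _ => integrable_finsetSum _ fun m' _ => hterm m m')
    hone, integral_finsetSum _ (fun m _ => integrable_finsetSum _ fun m' _ => hterm m m')]
  congr 1
  · refine Finset.sum_congr rfl fun m hm => ?_
    rw [integral_finsetSum _ (fun m' _ => hterm m m'), Finset.sum_eq_single m]
    · rw [hν, integral_prod_mul (fun μ => f μ * (latitudeFactor l m μ * latitudeFactor l m μ))
        (fun φ : ℝ => (c m * Complex.exp (Complex.I * m * φ)).re *
          (c m * Complex.exp (Complex.I * m * φ)).re),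
        integral_re_mul_re, integral_Ioo_mul_latitudeFactor f hf hb, if_pos rfl]
      by_cases h0 : m = 0
      · subst h0; rw [if_pos rfl, if_pos rfl, if_pos rfl]; ring
      · simp only [if_neg h0]
        rw [Complex.mul_conj, Complex.ofReal_re]; ring
    · intro m' _ hne
      rw [hν, integral_prod_mul (fun μ => f μ * (latitudeFactor l m μ * latitudeFactor l m' μ))
        (fun φ : ℝ => (c m * Complex.exp (Complex.I * m * φ)).re *
          (c m' * Complex.exp (Complex.I * m' * φ)).re),
        integral_re_mul_re, if_neg hne.symm, mul_zero]
    · exact fun h => absurd hm h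
  · rw [hν, integral_prod_mul (fun μ => f μ) (fun _ : ℝ => (1 : ℝ)),
      intervalIntegral.integral_of_le (by norm_num), integral_Ioc_eq_integral_Ioo]
    simp [Real.pi_pos.le]; ring

/-! ### The random eigenfunction as a real harmonic -/

theorem sum_Icc_neg_eq {M : Type*} [AddCommMonoid M] (n : ℕ) (g : ℤ → M) :
    ∑ m ∈ Finset.Icc (-(n : ℤ)) n, g m =
      g 0 + ∑ m ∈ Finset.range n, (g ((m + 1 : ℕ) : ℤ) + g (-((m + 1 : ℕ) : ℤ))) := by
  induction n with
  | zero => simp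
  | succ n ih =>
    have e : Finset.Icc (-((n + 1 : ℕ) : ℤ)) ((n + 1 : ℕ) : ℤ) =
        insert ((n + 1 : ℕ) : ℤ) (insert (-((n + 1 : ℕ) : ℤ)) (Finset.Icc (-(n : ℤ)) n)) := by
      ext x; simp; omega
    rw [e, Finset.sum_insert (by simp; omega), Finset.sum_insert (by simp), ih,
      Finset.sum_range_succ]
    abel

theorem abs_third_le_one (x : S2) : |x.1 2| ≤ 1 := by
  have h : ‖x.1‖ = 1 := by simp
  have h2 := PiLp.norm_apply_le x.1 2
  rwa [h] at h2

theorem cos_colatitude (x : S2) : Real.cos (colatitude x) = x.1 2 :=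
  Real.cos_arccos (abs_le.1 (abs_third_le_one x)).1 (abs_le.1 (abs_third_le_one x)).2

theorem re_mul_harmonic (l m : ℕ) (x : S2) (c : ℂ) :
    (c * harmonic l m (colatitude x) (longitude x)).re =
      Real.sqrt ((2 * l + 1) / (4 * Real.pi)) *
        (Real.sqrt (((l - m).factorial : ℝ) / ((l + m).factorial : ℝ)) *
          assocLegendre l m (x.1 2) * (c * Complex.exp (Complex.I * m * longitude x)).re) := by
  rw [harmonic, if_pos (Int.natCast_nonneg m), harmonicNonneg, cos_colatitude, mul_left_comm,
    Complex.re_ofReal_mul, Int.natAbs_natCast]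
  ring

/-- Both coefficient and harmonic of order `-(m+1)` are, up to the same sign, conjugates of those of
order `m+1`. Equal real parts explain the factor `2` in `latitudeFactor`. -/
theorem re_mul_harmonic_neg (l m : ℕ) (x : S2) (c c' : ℂ)
    (h : c = (-1) ^ (m + 1) * (starRingEnd ℂ) c') :
    (c' * harmonic l (-((m + 1 : ℕ) : ℤ)) (colatitude x) (longitude x)).re =
      (c * harmonic l ((m + 1 : ℕ) : ℤ) (colatitude x) (longitude x)).re := by
  have hneg : ¬ (0 : ℤ) ≤ -((m + 1 : ℕ) : ℤ) := by push_cast; omega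
  rw [harmonic, if_neg hneg, harmonic, if_pos (Int.natCast_nonneg _), Int.natAbs_neg, h,
    ← Complex.conj_re]
  congr 1
  simp only [map_mul, map_pow, map_neg, map_one, Complex.conj_conj, Int.natAbs_natCast]
  ring

theorem randomHarmonic_eq {Ω : Type*} (l : ℕ) (a : ℤ → Ω → ℂ) (ω : Ω)
    (h : ∀ m : ℕ, m ≤ l → a m ω = (-1) ^ m * (starRingEnd ℂ) (a (-(m : ℤ)) ω)) (x : S2) :
    randomHarmonic l a x ω = realHarmonic l (fun m => a m ω) (cylindrical x) := by
  have hs : Real.sqrt (4 * Real.pi / (2 * l + 1)) * Real.sqrt ((2 * l + 1) / (4 * Real.pi)) = 1 := by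
    have := Real.pi_pos
    rw [← Real.sqrt_mul (by positivity), Real.sqrt_eq_one]
    field_simp
  rw [randomHarmonic, sum_Icc_neg_eq, Complex.add_re, Complex.re_sum, realHarmonic,
    Finset.sum_range_succ', mul_add, Finset.mul_sum,
    add_comm (Real.sqrt _ * (a 0 ω * harmonic l 0 _ _).re)]
  congr 1
  · refine Finset.sum_congr rfl fun m hm => ?_
    rw [Complex.add_re, re_mul_harmonic_neg l m x _ _ (h (m + 1) (Finset.mem_range.1 hm)),
      re_mul_harmonic, latitudeFactor, if_neg (Nat.succ_ne_zero m)]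
    simp only [cylindrical]
    linear_combination 2 * (Real.sqrt (((l - (m + 1)).factorial : ℝ) / ((l + (m + 1)).factorial : ℝ))
      * assocLegendre l (m + 1) (x.1 2) *
      (a ((m + 1 : ℕ) : ℤ) ω * Complex.exp (Complex.I * ((m + 1 : ℕ) : ℂ) * longitude x)).re) * hs
  · have h0 := re_mul_harmonic l 0 x (a 0 ω)
    simp only [Nat.cast_zero] at h0 ⊢
    rw [h0, latitudeFactor, if_pos rfl]
    simp only [cylindrical]
    linear_combination (Real.sqrt (((l - 0).factorial : ℝ) / ((l + 0).factorial : ℝ))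
      * assocLegendre l 0 (x.1 2) *
      (a 0 ω * Complex.exp (Complex.I * 0 * longitude x)).re) * hs

theorem aeval_hermite_two (t : ℝ) : aeval t (hermite 2) = t ^ 2 - 1 := by
  simp [hermite_succ]; ring

/-- The quadratic form of the single coefficient of order `m`. -/
noncomputable def coeffForm (m : ℕ) (z : ℂ) : ℝ :=
  if m = 0 then 2 * Real.pi * z.re ^ 2 else 4 * Real.pi * Complex.normSq z

theorem measurable_coeffForm (m : ℕ) : Measurable (coeffForm m) := by
  unfold coeffForm
  split_ifs
  · fun_prop
  · exact Complex.continuous_normSq.measurable.const_mul _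

theorem secondChaos_ae_eq {Ω : Type*} [MeasurableSpace Ω] {P : Measure Ω} {l : ℕ} {a : ℤ → Ω → ℂ}
    (ha : IsGaussianCoeff P l a) (k : ℕ) (r : ℝ) {ε : ℝ} (hε : 0 < ε) :
    secondChaos k r ε l a =ᵐ[P] fun ω => ∑ m : Fin (l + 1),
      weightedInt (capWeight k r ε) (measurable_capWeight k r ε) (abs_capWeight_le k r hε)
        (assocSq l m) * coeffForm m (a ((m : ℕ) : ℤ) ω) -
      2 * Real.pi * ∫ μ in (-1 : ℝ)..1, capWeight k r ε μ := by
  have h : ∀ᵐ ω ∂P, ∀ m : ℕ, m ≤ l → a m ω = (-1) ^ m * (starRingEnd ℂ) (a (-(m : ℤ)) ω) := by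
    rw [ae_all_iff]
    intro m
    by_cases hm : m ≤ l
    · filter_upwards [ha.conj_symm m hm] with ω hω _ using hω
    · exact Filter.Eventually.of_forall fun ω h => absurd h hm
  filter_upwards [h] with ω hω
  have h2 := integral_surface_sq (capWeight k r ε) (measurable_capWeight k r ε)
    (abs_capWeight_le k r hε) l (fun m => a m ω)
  rw [secondChaos]
  simp only [randomHarmonic_eq l a ω hω, aeval_hermite_two]
  refine Eq.trans ?_ (h2.trans ?_)
  · rfl
  · rw [Finset.sum_range]
    congr 1
    refine Finset.sum_congr rfl fun m _ => ?_
    rw [coeffForm]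
    by_cases h0 : (m : ℕ) = 0
    · simp [h0]
    · simp [h0]

/-! ### Gaussian moments -/

theorem integral_pow_four_gaussianReal (v : NNReal) :
    ∫ x, x ^ 4 ∂gaussianReal 0 v = 3 * (v : ℝ) ^ 2 := by
  have h := iteratedDeriv_mgf_zero (X := fun x : ℝ => x) (μ := gaussianReal 0 v) (by simp) 4
  have h2 : ∫ x, x ^ 4 ∂gaussianReal 0 v = iteratedDeriv 4 (mgf (fun x => x) (gaussianReal 0 v)) 0 :=
    h.symm
  rw [h2, mgf_fun_id_gaussianReal]
  have hE : ∀ t : ℝ, HasDerivAt (fun t : ℝ => Real.exp (0 * t + v * t ^ 2 / 2))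
      (v * t * Real.exp (0 * t + v * t ^ 2 / 2)) t := by
    intro t
    have : HasDerivAt (fun t : ℝ => 0 * t + v * t ^ 2 / 2) (v * t) t := by
      have h := ((hasDerivAt_id t).const_mul 0).add
        (((hasDerivAt_pow 2 t).const_mul (v : ℝ)).div_const 2)
      refine h.congr_deriv ?_
      simp; ring
    exact (this.exp).congr_deriv (by ring)
  -- Differentiating `p(t) e^{vt²/2}` acts on the prefactor as `p ↦ p' + vXp`; four steps from `p =
  -- 1` give the fourth moment at `t = 0`.
  have hD : ∀ p : ℝ[X], deriv (fun t : ℝ => p.eval t * Real.exp (0 * t + v * t ^ 2 / 2)) =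
      fun t => (derivative p + C (v : ℝ) * X * p).eval t *
        Real.exp (0 * t + v * t ^ 2 / 2) := by
    intro p
    ext t
    refine ((p.hasDerivAt t).mul (hE t)).deriv.trans ?_
    simp; ring
  have h0 : (fun t : ℝ => Real.exp (0 * t + v * t ^ 2 / 2)) =
      fun t => (1 : ℝ[X]).eval t * Real.exp (0 * t + v * t ^ 2 / 2) := by simp
  rw [h0, iteratedDeriv_succ, iteratedDeriv_succ, iteratedDeriv_succ, iteratedDeriv_one, hD, hD, hD,
    hD]
  simp; ring

theorem memLp_sq_gaussianReal (v : NNReal) :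
    MemLp (fun x : ℝ => x ^ 2) 2 (gaussianReal 0 v) := by
  rw [memLp_two_iff_integrable_sq (by fun_prop)]
  have h := (memLp_id_gaussianReal (μ := 0) (v := v) 4).integrable_norm_pow (by norm_num)
  refine h.congr (Filter.Eventually.of_forall fun x => ?_)
  simp only [id, Real.norm_eq_abs]
  rw [show |x| ^ 4 = (|x| ^ 2) ^ 2 by ring, sq_abs]

theorem variance_sq_gaussianReal (v : NNReal) :
    variance (fun x : ℝ => x ^ 2) (gaussianReal 0 v) = 2 * (v : ℝ) ^ 2 := by
  have h1 : ∫ x, x ^ 2 ∂gaussianReal 0 v = v := by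
    have h := variance_fun_id_gaussianReal (μ := 0) (v := v)
    have hm : MemLp (fun x : ℝ => x) 2 (gaussianReal 0 v) := memLp_id_gaussianReal' 2 (by simp)
    rw [variance_eq_sub hm] at h
    simp at h
    exact h
  rw [variance_eq_sub (memLp_sq_gaussianReal v)]
  have h2 : ∫ x, ((fun x : ℝ => x ^ 2) ^ 2) x ∂gaussianReal 0 v = 3 * (v : ℝ) ^ 2 := by
    rw [← integral_pow_four_gaussianReal]
    refine integral_congr_ae (Filter.Eventually.of_forall fun x => ?_)
    simp; ring
  rw [h1, h2]; ring

/-- `|z|²` is a sum of two independent squares, each of variance `2 · (1/2)² = 1/2`. -/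
theorem memLp_normSq_stdComplexGaussian : MemLp Complex.normSq 2 stdComplexGaussian ∧
    variance Complex.normSq stdComplexGaussian = 1 := by
  have hmeas : Measurable fun p : ℝ × ℝ => (⟨p.1, p.2⟩ : ℂ) :=
    Complex.measurableEquivRealProd.symm.measurable
  have hn := Complex.continuous_normSq.measurable
  set γ := gaussianReal 0 (1 / 2)
  have h1 : MemLp (fun p : ℝ × ℝ => p.1 ^ 2) 2 (γ.prod γ) :=
    (memLp_sq_gaussianReal (1 / 2)).comp_fst γ
  have h2 : MemLp (fun p : ℝ × ℝ => p.2 ^ 2) 2 (γ.prod γ) :=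
    (memLp_sq_gaussianReal (1 / 2)).comp_snd γ
  have e : Complex.normSq ∘ (fun p : ℝ × ℝ => (⟨p.1, p.2⟩ : ℂ)) =
      (fun p : ℝ × ℝ => p.1 ^ 2) + fun p => p.2 ^ 2 := by
    ext p; simp [Complex.normSq_mk]; ring
  constructor
  · rw [stdComplexGaussian, memLp_map_measure_iff hn.aestronglyMeasurable hmeas.aemeasurable, e]
    exact h1.add h2
  · rw [stdComplexGaussian, variance_map hn.aemeasurable hmeas.aemeasurable, e,
      IndepFun.variance_add h1 h2 (indepFun_prod (X := fun x : ℝ => x ^ 2) (Y := fun x : ℝ => x ^ 2)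
        (by fun_prop) (by fun_prop))]
    have v1 : variance (fun p : ℝ × ℝ => p.1 ^ 2) (γ.prod γ) = 1 / 2 := by
      have := (measurePreserving_fst (μ := γ) (ν := γ)).map_eq
      have h := variance_map (X := fun x : ℝ => x ^ 2) (Y := Prod.fst) (μ := γ.prod γ)
        (by fun_prop) (by fun_prop)
      rw [this, variance_sq_gaussianReal] at h
      refine h.symm.trans ?_
      norm_num
    have v2 : variance (fun p : ℝ × ℝ => p.2 ^ 2) (γ.prod γ) = 1 / 2 := by
      have := (measurePreserving_snd (μ := γ) (ν := γ)).map_eq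
      have h := variance_map (X := fun x : ℝ => x ^ 2) (Y := Prod.snd) (μ := γ.prod γ)
        (by fun_prop) (by fun_prop)
      rw [this, variance_sq_gaussianReal] at h
      refine h.symm.trans ?_
      norm_num
    rw [v1, v2]; norm_num

theorem coeffForm_moments {Ω : Type*} [MeasurableSpace Ω] {P : Measure Ω} {l : ℕ}
    {a : ℤ → Ω → ℂ} (ha : IsGaussianCoeff P l a) {m : ℕ} (hm : m ≤ l) :
    MemLp (fun ω => coeffForm m (a m ω)) 2 P ∧
      variance (fun ω => coeffForm m (a m ω)) P =
        (if m = 0 then 1 else 2) * (8 * Real.pi ^ 2) := by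
  by_cases h0 : m = 0
  · subst h0
    have h := ha.law_zero
    have hsq : MemLp (fun ω => (a 0 ω).re ^ 2) 2 P := by
      have h2 := memLp_sq_gaussianReal 1
      rw [← h.map_eq, memLp_map_measure_iff (by fun_prop) h.aemeasurable] at h2
      exact h2
    have hv : variance (fun ω => (a 0 ω).re ^ 2) P = 2 := by
      have h2 := variance_sq_gaussianReal 1
      rw [← h.map_eq, variance_map (by fun_prop) h.aemeasurable] at h2
      refine Eq.trans h2 ?_
      norm_num
    simp only [coeffForm, if_true, Nat.cast_zero]
    refine ⟨hsq.const_mul _, ?_⟩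
    rw [variance_const_mul, hv]; ring
  · have h := ha.law_pos m (by omega) hm
    obtain ⟨h1, h2⟩ := memLp_normSq_stdComplexGaussian
    have hn := Complex.continuous_normSq.measurable
    rw [← h.map_eq, memLp_map_measure_iff hn.aestronglyMeasurable h.aemeasurable] at h1
    rw [← h.map_eq, variance_map hn.aemeasurable h.aemeasurable] at h2
    simp only [coeffForm, if_neg h0]
    refine ⟨h1.const_mul _, ?_⟩
    rw [variance_const_mul]
    refine (congrArg _ h2).trans ?_
    ring

/-- Independence makes variances add. The weights `1` and `2` come from `(2π)² · 2 = 8π²` at order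
zero and `(4π)² · 1 = 16π²` at positive orders. -/
theorem variance_secondChaos {Ω : Type*} [MeasurableSpace Ω] {P : Measure Ω}
    [IsProbabilityMeasure P] {l : ℕ} {a : ℤ → Ω → ℂ}
    (ha : IsGaussianCoeff P l a) (k : ℕ) (r : ℝ) {ε : ℝ} (hε : 0 < ε) :
    let W := weightedInt (capWeight k r ε) (measurable_capWeight k r ε) (abs_capWeight_le k r hε)
    variance (secondChaos k r ε l a) P = 8 * Real.pi ^ 2 *
      (W (assocSq l 0) ^ 2 + 2 * ∑ m ∈ Finset.range l, W (assocSq l (m + 1)) ^ 2) := by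
  intro W
  have hmem : ∀ m : Fin (l + 1), MemLp (fun ω => W (assocSq l m) *
      coeffForm m (a ((m : ℕ) : ℤ) ω)) 2 P := fun m =>
    (coeffForm_moments ha (Nat.lt_succ_iff.1 m.2)).1.const_mul _
  have hind : iIndepFun (fun (m : Fin (l + 1)) ω => W (assocSq l m) *
      coeffForm m (a ((m : ℕ) : ℤ) ω)) P :=
    ha.indep.comp (fun m z => W (assocSq l m) * coeffForm m z)
      fun m => (measurable_coeffForm m).const_mul _
  have hsum : MemLp (fun ω => ∑ m : Fin (l + 1), W (assocSq l m) *
      coeffForm m (a ((m : ℕ) : ℤ) ω)) 2 P := memLp_finsetSum _ fun m _ => hmem m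
  rw [variance_congr (secondChaos_ae_eq ha k r hε),
    variance_sub_const hsum.aestronglyMeasurable]
  have hv := IndepFun.variance_sum (s := Finset.univ) (μ := P)
    (X := fun (m : Fin (l + 1)) ω => W (assocSq l m) * coeffForm m (a ((m : ℕ) : ℤ) ω))
    (fun m _ => hmem m) (fun i _ j _ hij => hind.indepFun hij)
  have e : (∑ m : Fin (l + 1), fun ω => W (assocSq l m) * coeffForm m (a ((m : ℕ) : ℤ) ω)) =
      fun ω => ∑ m : Fin (l + 1), W (assocSq l m) * coeffForm m (a ((m : ℕ) : ℤ) ω) := by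
    ext ω; simp
  rw [e] at hv
  rw [hv]
  have hterm : ∀ m : Fin (l + 1), variance (fun ω => W (assocSq l m) *
      coeffForm m (a ((m : ℕ) : ℤ) ω)) P =
      W (assocSq l m) ^ 2 * ((if (m : ℕ) = 0 then 1 else 2) * (8 * Real.pi ^ 2)) := fun m => by
    rw [variance_const_mul, (coeffForm_moments ha (Nat.lt_succ_iff.1 m.2)).2]
  simp only [hterm]
  rw [← Finset.sum_range (f := fun m => W (assocSq l m) ^ 2 *
    ((if m = 0 then 1 else 2) * (8 * Real.pi ^ 2))), Finset.sum_range_succ']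
  simp only [if_neg (Nat.succ_ne_zero _), if_true, ← Finset.sum_mul]
  ring

/-! ### The expansion and the bounds -/

theorem fourierCoeff_sq (k : ℕ) (r : ℝ) {ε : ℝ} (hε : 0 < ε) (L : ℕ) :
    CapHarmonics.fourierCoeff k r ε L ^ 2 * (1 / (2 * (L : ℝ) + 1)) =
      Real.pi * weightedInt (capWeight k r ε) (measurable_capWeight k r ε)
        (abs_capWeight_le k r hε) (legendre L) ^ 2 := by
  have hπ := Real.pi_pos
  rw [CapHarmonics.fourierCoeff, mul_pow, mul_pow, Real.sq_sqrt (by positivity)]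
  have : (0 : ℝ) < 2 * L + 1 := by positivity
  change _ * weightedInt (capWeight k r ε) (measurable_capWeight k r ε)
    (abs_capWeight_le k r hε) (legendre L) ^ 2 * _ = _
  field_simp
  ring

theorem assocSq_sum_sq_le (l : ℕ) (f : ℝ → ℝ) (hf : Measurable f) (hb : ∀ x, |f x| ≤ 1) :
    weightedInt f hf hb (assocSq l 0) ^ 2 +
      2 * ∑ m ∈ Finset.range l, weightedInt f hf hb (assocSq l (m + 1)) ^ 2 ≤
    4 / (2 * l + 1) := by
  have hm : ∀ m ≤ l, weightedInt f hf hb (assocSq l m) ^ 2 ≤ (2 / (2 * l + 1)) ^ 2 := by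
    intro m hm
    rw [← sq_abs]
    have := abs_weightedInt_assocSq_le f hf hb hm
    gcongr
  have h1 := hm 0 (Nat.zero_le _)
  have h2 : ∑ m ∈ Finset.range l, weightedInt f hf hb (assocSq l (m + 1)) ^ 2 ≤
      l * (2 / (2 * l + 1)) ^ 2 := by
    have := Finset.sum_le_card_nsmul (Finset.range l)
      (fun m => weightedInt f hf hb (assocSq l (m + 1)) ^ 2)
      ((2 / (2 * l + 1)) ^ 2) (fun m h => hm (m + 1) (Finset.mem_range.1 h))
    simpa using this
  have e : (4 : ℝ) / (2 * l + 1) = (2 / (2 * l + 1)) ^ 2 + 2 * (l * (2 / (2 * l + 1)) ^ 2) := by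
    field_simp; ring
  rw [e]
  linarith

/-- All terms of the Legendre form are non-negative, since their coefficients are squares of
Clebsch-Gordan coefficients; the term `L = 0` equals `(∫ f)²/(2l+1)`. -/
theorem le_assocSq_sum_sq {l : ℕ} (hl : 1 ≤ l) (f : ℝ → ℝ) (hf : Measurable f)
    (hb : ∀ x, |f x| ≤ 1) {δ : ℝ} (hδ : 0 ≤ δ) (h : δ ≤ ∫ μ in (-1 : ℝ)..1, f μ) :
    δ ^ 2 / (2 * l + 1) ≤ weightedInt f hf hb (assocSq l 0) ^ 2 +
      2 * ∑ m ∈ Finset.range l, weightedInt f hf hb (assocSq l (m + 1)) ^ 2 := by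
  rw [assocSq_sum_sq]
  refine le_trans ?_ (Finset.single_le_sum (f := fun L : ℕ => (2 * (L : ℝ) + 1) / 2 *
    polyInt (legendre l ^ 2 * legendre L) * weightedInt f hf hb (legendre L) ^ 2)
    (fun L hL => ?_) (Finset.mem_range.2 (Nat.succ_pos _)))
  · have hI : δ ≤ weightedInt f hf hb (legendre 0) := by
      rw [weightedInt_apply]
      simpa [legendre_zero] using h
    rw [legendre_zero, mul_one, sq (legendre l), polyInt_legendre_sq, ← legendre_zero]
    have h3 : (2 * ((0 : ℕ) : ℝ) + 1) / 2 * (2 / (2 * l + 1)) *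
        weightedInt f hf hb (legendre 0) ^ 2 =
        weightedInt f hf hb (legendre 0) ^ 2 / (2 * l + 1) := by
      push_cast; field_simp; ring
    rw [h3]
    gcongr
  · rw [Finset.mem_range] at hL
    rw [← clebschGordan_sq_eq_polyInt hl L (by omega)]
    positivity

theorem hasSum_variance_secondChaos {Ω : Type*} [MeasurableSpace Ω] {P : Measure Ω}
    [IsProbabilityMeasure P] {l : ℕ} (hl : 1 ≤ l) {a : ℤ → Ω → ℂ}
    (ha : IsGaussianCoeff P l a) (k : ℕ) (r : ℝ) {ε : ℝ} (hε : 0 < ε) :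
    HasSum (fun L : ℕ => 8 * Real.pi * (CapHarmonics.fourierCoeff k r ε L ^ 2 *
        (1 / (2 * (L : ℝ) + 1)) * clebschGordan l 0 l 0 L 0 ^ 2))
      (variance (secondChaos k r ε l a) P) := by
  have hs : ∀ L ∉ Finset.range (2 * l + 1), 8 * Real.pi *
      (CapHarmonics.fourierCoeff k r ε L ^ 2 * (1 / (2 * (L : ℝ) + 1)) *
        clebschGordan l 0 l 0 L 0 ^ 2) = 0 := by
    intro L hL
    rw [Finset.mem_range] at hL
    rw [clebschGordan_eq_zero (by omega)]; simp
  have h : HasSum _ _ (SummationFilter.unconditional ℕ) := hasSum_sum_of_ne_finset_zero hs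
  convert h using 1
  rw [variance_secondChaos ha k r hε, assocSq_sum_sq, Finset.mul_sum]
  refine Finset.sum_congr rfl fun L hL => ?_
  rw [Finset.mem_range] at hL
  rw [fourierCoeff_sq k r hε, clebschGordan_sq_eq_polyInt hl L (by omega)]
  ring

end CapHarmonics

/-! ### The two-sided bound -/

theorem lemma4p3 (r : ℝ) (hr0 : 0 < r) (hrπ : r < Real.pi) :
    ∃ c₁ c₂ : ℝ, 0 < c₁ ∧ c₁ ≤ c₂ ∧
      ∀ (k : ℕ) (ε : ℝ), 0 < ε → ε < r → ∀ l : ℕ, 1 ≤ l →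
      ∀ (Ω : Type*) [MeasurableSpace Ω] (P : Measure Ω) [IsProbabilityMeasure P]
        (a : ℤ → Ω → ℂ), CapHarmonics.IsGaussianCoeff P l a →
        HasSum
            (fun L : ℕ => 8 * Real.pi * (CapHarmonics.fourierCoeff k r ε L ^ 2 *
              (1 / (2 * (L : ℝ) + 1)) * CapHarmonics.clebschGordan l 0 l 0 L 0 ^ 2))
            (variance (CapHarmonics.secondChaos k r ε l a) P) ∧
          c₁ / l ≤ variance (CapHarmonics.secondChaos k r ε l a) P ∧
          variance (CapHarmonics.secondChaos k r ε l a) P ≤ c₂ / l := by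
  set δ := (1 - Real.cos (r / 2)) / 2 with hδ
  have hcos : Real.cos (r / 2) < 1 := by
    rw [← Real.cos_zero]
    exact Real.cos_lt_cos_of_nonneg_of_le_pi le_rfl (by linarith) (by linarith)
  have hδ0 : 0 < δ := by rw [hδ]; linarith
  have hδ1 : δ ≤ 1 := by have := Real.neg_one_le_cos (r / 2); rw [hδ]; linarith
  have hπ := Real.pi_pos
  -- For `l ≥ 1`, `2l + 1 ≤ 3l` turns `δ²/(2l+1)` into `(δ²/3)/l`, and `2l + 1 ≥ 2l` turns
  -- `4/(2l+1)` into `2/l`.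
  refine ⟨8 * Real.pi ^ 2 * (δ ^ 2 / 3), 8 * Real.pi ^ 2 * 2, by positivity, ?_, ?_⟩
  · have : δ ^ 2 ≤ 1 := by nlinarith
    gcongr; linarith
  intro k ε hε hεr l hl Ω _ P _ a ha
  have hl' : (1 : ℝ) ≤ l := by exact_mod_cast hl
  refine ⟨CapHarmonics.hasSum_variance_secondChaos hl ha k r hε, ?_, ?_⟩
  · rw [CapHarmonics.variance_secondChaos ha k r hε, mul_div_assoc]
    refine mul_le_mul_of_nonneg_left (le_trans ?_ (CapHarmonics.le_assocSq_sum_sq hl _ _ _ hδ0.le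
      (CapHarmonics.integral_capWeight_ge k hrπ hε hεr))) (by positivity)
    rw [div_div]
    gcongr
    linarith
  · rw [CapHarmonics.variance_secondChaos ha k r hε, mul_div_assoc]
    refine mul_le_mul_of_nonneg_left ((CapHarmonics.assocSq_sum_sq_le l _ _ _).trans ?_)
      (by positivity)
    rw [div_le_div_iff₀ (by positivity) (by positivity)]
    linarith
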